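/- Let $f$ be a transcendental meromorphic function on $\mathbb{C}$ (that is, meromorphic on $\mathbb{C}$ and not rational) having no simple poles. Call a meromorphic function $b\not\equiv 0$ on $\mathbb{C}$ a small function of $f$ if $T(r,b)=o(T(r,f))$ as $r\to\infty$ outside some set of positive real numbers of finite Lebesgue measure, where $T(r,\cdot)$ denotes the Nevanlinna characteristic. Let $a$ and $\varphi$ be small functions of $f$ (in particular $a\not\equiv 0$ and $\varphi\not\equiv 0$), let $k\ge 1$, and let $q_0\ge 2$, $q_1,\ldots,q_{k-1}\ge 0$ and $q_k\ge 1$ be integers. Put $$M[f]=a\,(f)^{q_0}(f')^{q_1}\cdots (f^{(k)})^{q_k}.$$ Then $M[f]-\varphi$ is not identically zero and has infinitely many zeros in $\mathbb{C}$. -/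

import Mathlib

open Filter Topology MeasureTheory Asymptotics

/-- `f` represents a transcendental meromorphic function on the complex plane: it is meromorphic
on `ℂ` and is not a rational function. As usual, meromorphic functions are identified when they
agree off a closed discrete set (the value stored at a pole is irrelevant). -/
def IsTranscendentalMeromorphic (f : ℂ → ℂ) : Prop :=
  Meromorphic f ∧
    ¬ ∃ p q : Polynomial ℂ, q ≠ 0 ∧ f =ᶠ[codiscrete ℂ] fun z ↦ p.eval z / q.eval z

/-- `b` is a small function with respect to `f`: a meromorphic function on `ℂ`, not identically
zero, with `T(r, b) = o(T(r, f))` as `r → ∞` outside a set of positive reals of finite linear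
measure. Here `T(r, ·) = ValueDistribution.characteristic · ⊤ r` is the Nevanlinna
characteristic. -/
def IsSmallFunction (b f : ℂ → ℂ) : Prop :=
  Meromorphic b ∧ ¬ b =ᶠ[codiscrete ℂ] 0 ∧
    ∃ E : Set ℝ, E ⊆ Set.Ioi 0 ∧ volume E < ⊤ ∧
      ValueDistribution.characteristic b ⊤ =o[atTop ⊓ 𝓟 Eᶜ]
        ValueDistribution.characteristic f ⊤

/-- The differential monomial `M[f] = a f ^ q₀ (f') ^ q₁ ⋯ (f⁽ᵏ⁾) ^ qₖ`. -/
noncomputable def differentialMonomial (a : ℂ → ℂ) (k : ℕ) (q : ℕ → ℕ) (f : ℂ → ℂ) : ℂ → ℂ :=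
  fun z ↦ a z * ∏ i ∈ Finset.range (k + 1), iteratedDeriv i f z ^ q i

/-- The zeros of a meromorphic function: the points at which its order is positive and finite.
(A point near which the function vanishes identically has order `⊤` and is not counted; removable
singularities are taken care of, since the order does not depend on the value at the point.) -/
def meromorphicZeros (g : ℂ → ℂ) : Set ℂ :=
  {z | 0 < meromorphicOrderAt g z ∧ meromorphicOrderAt g z ≠ ⊤}

/-! Put `b = a / φ` and `F = b f^{q₀} (f')^{q₁} ⋯`, so that `M[f] - φ = φ (F - 1)`. If `M[f] - φ`
had only finitely many zeros, the zeros of `F - 1` would be counted by `o(T(r, f))`. This is refuted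
by bounding `T(r, 1/f)` by about half of `T(r, f)`, against Jensen's `T(r, 1/f) = T(r, f) + O(1)`.

Let `G = F' / (F - 1)`. The identity `1/F = 1 - G⁻¹ (F'/F)`, Jensen's formula for `G` and the lemma
on the logarithmic derivative give `m(r, 1/F) ≤ -N(r, div G) + o(T)`, with the signed divisor of `G`
(`exists_proximity_inv_le`). Dividing each derivative by `f` shows `m(r, 1/f) ≤ m(r, 1/F) + o(T)`
(`exists_mul_proximity_inv_le`). Point by point, `2 (div f)⁺ ≤ (div f)⁻ + 2 div G`, up to zeros of
`F - 1` and the divisor of `b` (`divisor_le`): at a zero of `f` the exponent `q₀ ≥ 2` makes `G`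
vanish to high order, and at a pole the multiplicity at least two pays for the simple pole that `G`
may have. In the sum the terms in `div G` cancel, leaving `2 T(r, 1/f) ≤ N(r, f) + o(T)`.

The analytic input is the lemma on the logarithmic derivative together with `log r = o(T(r, f))` for
transcendental `f`; both rest on the Herglotz representation of `log |g|` for zero-free `g`. -/

/-! ### Estimates on circles and Borel's growth lemma -/

open Metric Complex in
/-- On a disc, the logarithmic derivative of a zero-free holomorphic function is controlled by the
mean of `|log ‖g‖|` over the boundary circle. -/
theorem norm_logDeriv_le_circleAverage {g : ℂ → ℂ} {R : ℝ}
    (hg : AnalyticOnNhd ℂ g (closedBall 0 R)) (hg0 : ∀ z ∈ closedBall 0 R, g z ≠ 0)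
    {w : ℂ} (hw : w ∈ ball 0 R) :
    ‖logDeriv g w‖ ≤ 2 * R / (R - ‖w‖) ^ 2 * Real.circleAverage (fun z ↦ |Real.log ‖g z‖|) 0 R := by
  have hR : 0 < R := (norm_nonneg w).trans_lt (mem_ball_zero_iff.1 hw)
  have hwR : ‖w‖ < R := mem_ball_zero_iff.1 hw
  set u : ℂ → ℝ := fun z ↦ Real.log ‖g z‖ with hu
  have hharm : InnerProductSpace.HarmonicOnNhd u (closedBall 0 R) := fun z hz ↦
    (hg z hz).harmonicAt_log_norm (hg0 z hz)
  have hint : CircleIntegrable u 0 R :=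
    MeromorphicOn.circleIntegrable_log_norm_of_nonneg
      (fun z hz ↦ (hg z (sphere_subset_closedBall hz)).meromorphicAt) hR.le
  have hintC : CircleIntegrable (fun z ↦ (u z : ℂ)) 0 R := by
    simp only [CircleIntegrable, intervalIntegrable_iff] at hint ⊢
    exact Complex.ofRealCLM.integrable_comp hint
  -- The Herglotz integral of `log ‖g‖` has real part `log ‖g‖`. Hence `g * exp (-H)` has modulus
  -- one, is constant by the maximum principle, and `g' / g = H'`.
  set H : ℂ → ℂ := fun w ↦ Real.circleAverage (fun ζ ↦ herglotzRieszKernel 0 w ζ • (u ζ : ℂ)) 0 R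
    with hH
  have hHd : ∀ z ∈ ball (0 : ℂ) R, HasDerivAt H
      (Real.circleAverage (fun ζ ↦ (2 * ζ / (ζ - z) ^ 2) • (u ζ : ℂ)) 0 R) z := fun z hz ↦
    hasDerivAt_circleAverage_herglotzRieszKernel_smul hintC hz
  have hHre : ∀ z ∈ ball (0 : ℂ) R, (H z).re = u z := fun z hz ↦ by
    rw [hH, re_circleAverage_herglotzRieszKernel_smul hint hz,
      hharm.circleAverage_re_herglotzRieszKernel_smul hz]
  have hnorm : ∀ z ∈ ball (0 : ℂ) R, ‖g z * exp (-H z)‖ = 1 := fun z hz ↦ by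
    have h0 := hg0 z (ball_subset_closedBall hz)
    rw [norm_mul, norm_exp, neg_re, hHre z hz, hu, Real.exp_neg,
      Real.exp_log (norm_pos_iff.2 h0), mul_inv_cancel₀ (norm_ne_zero_iff.2 h0)]
  have hgd : ∀ z ∈ ball (0 : ℂ) R, HasDerivAt g (deriv g z) z := fun z hz ↦
    (hg z (ball_subset_closedBall hz)).differentiableAt.hasDerivAt
  have hconst : Set.EqOn (fun z ↦ g z * exp (-H z)) (Function.const ℂ (g w * exp (-H w)))
      (ball 0 R) := by
    refine eqOn_of_isPreconnected_of_isMaxOn_norm (convex_ball 0 R).isPreconnected isOpen_ball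
      (fun z hz ↦ ((hgd z hz).differentiableAt.mul
        ((hHd z hz).differentiableAt.neg.cexp)).differentiableWithinAt) hw ?_
    intro z hz
    simp only [Set.mem_ofPred_eq, Function.comp_apply, hnorm z hz, hnorm w hw, le_refl]
  have hder : deriv g w = g w *
      Real.circleAverage (fun ζ ↦ (2 * ζ / (ζ - w) ^ 2) • (u ζ : ℂ)) 0 R := by
    have h1 := (hgd w hw).mul (hHd w hw).neg.cexp
    have h2 : HasDerivAt (fun z ↦ g z * exp (-H z)) 0 w :=
      (hasDerivAt_const w (g w * exp (-H w))).congr_of_eventuallyEq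
        (hconst.eventuallyEq_of_mem (isOpen_ball.mem_nhds hw))
    have h3 := h1.unique h2
    have h4 : exp (-H w) * (deriv g w - g w *
      Real.circleAverage (fun ζ ↦ (2 * ζ / (ζ - w) ^ 2) • (u ζ : ℂ)) 0 R) = 0 := by
      simp only [Pi.neg_apply] at h3
      linear_combination h3
    rcases mul_eq_zero.1 h4 with h | h
    · exact absurd h (exp_ne_zero _)
    · exact sub_eq_zero.1 h
  have h0 := hg0 w (ball_subset_closedBall hw)
  rw [logDeriv_apply, hder, mul_div_cancel_left₀ _ h0]
  have hle : ‖Real.circleAverage (fun ζ ↦ (2 * ζ / (ζ - w) ^ 2) • (u ζ : ℂ)) 0 R‖ ≤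
      Real.circleAverage (fun z ↦ 2 * R / (R - ‖w‖) ^ 2 * |u z|) 0 R := by
    rw [Real.circleAverage_def, Real.circleAverage_def, norm_smul, smul_eq_mul,
      Real.norm_of_nonneg (by positivity)]
    gcongr
    refine intervalIntegral.norm_integral_le_of_norm_le (by positivity)
      (Eventually.of_forall fun θ _ ↦ ?_) (hint.abs.const_mul _)
    rw [norm_smul, norm_div, norm_mul, norm_pow, norm_circleMap_zero, abs_of_pos hR,
      Complex.norm_ofNat, Complex.norm_real, Real.norm_eq_abs]
    gcongr
    · calc R - ‖w‖ = ‖circleMap 0 R θ‖ - ‖w‖ := by rw [norm_circleMap_zero, abs_of_pos hR]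
        _ ≤ _ := norm_sub_norm_le _ _
  refine hle.trans_eq ?_
  exact Real.circleAverage_fun_smul (a := 2 * R / (R - ‖w‖) ^ 2) (f := fun z ↦ |u z|)

-- Jordan's inequality `sin t ≥ 2 t / π` compares with `t ^ (-1/2)` on a quarter period; reflection
-- and periodicity do the rest.
open Real in
theorem intervalIntegrable_inv_sqrt_abs_sin (a b : ℝ) :
    IntervalIntegrable (fun t ↦ (√|sin t|)⁻¹) volume a b := by
  have hmeas : Measurable fun t : ℝ ↦ (√|sin t|)⁻¹ := by fun_prop
  have h1 : IntervalIntegrable (fun t ↦ (√|sin t|)⁻¹) volume 0 (π / 2) := by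
    have hr : IntervalIntegrable (fun t : ℝ ↦ (√(2 / π))⁻¹ * t ^ (-(1 / 2) : ℝ)) volume 0 (π / 2) :=
      (intervalIntegral.intervalIntegrable_rpow' (by norm_num)).const_mul _
    refine hr.mono_fun hmeas.aestronglyMeasurable ?_
    rw [Set.uIoc_of_le (by positivity)]
    filter_upwards [ae_restrict_mem measurableSet_Ioc] with t ht
    have ht0 : 0 < t := ht.1
    have hs := mul_le_sin ht0.le ht.2
    have hp : 0 < 2 / π * t := by positivity
    rw [Real.norm_of_nonneg (by positivity), Real.norm_of_nonneg (by positivity),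
      rpow_neg ht0.le, ← sqrt_eq_rpow, ← mul_inv, ← sqrt_mul (by positivity),
      abs_of_pos (hp.trans_le hs)]
    gcongr
  have h2 : IntervalIntegrable (fun t ↦ (√|sin t|)⁻¹) volume (π / 2) π := by
    have := (h1.comp_sub_left π).symm
    simpa [sin_pi_sub, sub_half] using this
  have hper : Function.Periodic (fun t ↦ (√|sin t|)⁻¹) π := fun t ↦ by
    simp [sin_add_pi]
  exact hper.intervalIntegrable (t := 0) pi_pos.ne' (by simpa using h1.trans h2) a b

-- Rotate `u` onto the nonnegative real axis and keep only the imaginary part, which does not see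
-- `‖u‖`. This is the source of uniformity in `u`.
open Real in
theorem mul_abs_sin_le_norm_circleMap_sub {r : ℝ} (hr : 0 < r) (u : ℂ) (θ : ℝ) :
    r * |sin (θ - u.arg)| ≤ ‖circleMap 0 r θ - u‖ := by
  have h1 : ‖circleMap 0 r θ - u‖ =
      ‖Complex.exp (-(u.arg : ℂ) * Complex.I) * (circleMap 0 r θ - u)‖ := by
    rw [norm_mul, ← Complex.ofReal_neg, Complex.norm_exp_ofReal_mul_I, one_mul]
  have h2 : Complex.exp (-(u.arg : ℂ) * Complex.I) * (circleMap 0 r θ - u) =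
      r * Complex.exp ((θ - u.arg : ℝ) * Complex.I) - ‖u‖ := by
    conv_lhs => rw [← Complex.norm_mul_exp_arg_mul_I u]
    rw [circleMap_zero, mul_sub, mul_left_comm, ← Complex.exp_add, mul_left_comm,
      Complex.norm_mul_exp_arg_mul_I, ← Complex.exp_add]
    push_cast
    rw [neg_mul, neg_add_cancel, Complex.exp_zero, mul_one]
    ring_nf
  rw [h1, h2]
  refine le_trans (le_of_eq ?_) (Complex.abs_im_le_norm _)
  rw [Complex.sub_im, Complex.ofReal_im, sub_zero, 
    Complex.im_ofReal_mul, Complex.exp_ofReal_mul_I_im, abs_mul, abs_of_pos hr]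

open Real in
/-- The mean of `‖z - u‖ ^ (-1/2)` over the circle of radius `r` is `O(r ^ (-1/2))`, uniformly in
`u`. -/
theorem exists_circleAverage_inv_sqrt_norm_sub_le :
    ∃ C : ℝ, 0 ≤ C ∧ ∀ r : ℝ, 0 < r → ∀ u : ℂ,
      CircleIntegrable (fun z ↦ (√‖z - u‖)⁻¹) 0 r ∧
      circleAverage (fun z ↦ (√‖z - u‖)⁻¹) 0 r ≤ C / √r := by
  refine ⟨(2 * π)⁻¹ * ∫ t in 0..2 * π, (√|sin t|)⁻¹, ?_, fun r hr u ↦ ?_⟩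
  · refine mul_nonneg (by positivity) (intervalIntegral.integral_nonneg (by positivity) ?_)
    intro t _; positivity
  have hI : IntervalIntegrable (fun θ ↦ (√r)⁻¹ * (√|sin (θ - u.arg)|)⁻¹) volume 0 (2 * π) := by
    refine IntervalIntegrable.const_mul ?_ _
    have := (intervalIntegrable_inv_sqrt_abs_sin (0 - u.arg) (2 * π - u.arg)).comp_sub_right u.arg
    simpa using this
  -- Zeros of the sine must be excluded: there the majorant is `0`, since `0⁻¹ = 0`.
  have hsin : ∀ᵐ θ : ℝ, sin (θ - u.arg) ≠ 0 := by
    have hc : {θ : ℝ | ¬ sin (θ - u.arg) ≠ 0} ⊆ Set.range fun n : ℤ ↦ (n : ℝ) * π + u.arg := by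
      intro θ hθ
      obtain ⟨n, hn⟩ := sin_eq_zero_iff.1 (not_not.1 hθ)
      exact ⟨n, by simp [hn]⟩
    exact (Set.countable_range _).mono hc |>.measure_zero volume
  have hle : ∀ᵐ θ : ℝ, (√‖circleMap 0 r θ - u‖)⁻¹ ≤ (√r)⁻¹ * (√|sin (θ - u.arg)|)⁻¹ := by
    filter_upwards [hsin] with θ hθ
    have := abs_pos.2 hθ
    rw [← mul_inv, ← sqrt_mul hr.le]
    gcongr
    exact mul_abs_sin_le_norm_circleMap_sub hr u θ
  have hint : CircleIntegrable (fun z ↦ (√‖z - u‖)⁻¹) 0 r := by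
    refine IntervalIntegrable.mono_fun hI ?_ ?_
    · exact Measurable.aestronglyMeasurable (by fun_prop)
    · refine ae_restrict_of_ae ?_
      filter_upwards [hle] with θ hθ
      rwa [Real.norm_of_nonneg (by positivity), Real.norm_of_nonneg (by positivity)]
  refine ⟨hint, ?_⟩
  rw [circleAverage_def, smul_eq_mul, mul_div_assoc]
  gcongr
  refine (intervalIntegral.integral_mono_ae (by positivity) hint hI hle).trans_eq ?_
  have hper : Function.Periodic (fun t ↦ (√|sin t|)⁻¹) (2 * π) := fun t ↦ by
    simp [sin_add_two_pi]
  rw [intervalIntegral.integral_const_mul, div_eq_inv_mul,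
    intervalIntegral.integral_comp_sub_right (fun t ↦ (√|sin t|)⁻¹) u.arg]
  have := hper.intervalIntegral_add_eq (0 - u.arg) 0
  rw [zero_add] at this
  rw [← this]
  ring_nf

/-- **Borel's growth lemma.** -/
theorem eventually_lt_two_mul_of_monotoneOn {S : ℝ → ℝ} {r₀ : ℝ} (hS : MonotoneOn S (Set.Ici r₀))
    (h1 : ∀ r ≥ r₀, 1 ≤ S r) :
    ∀ᶠ r in (volume : Measure ℝ).cofinite ⊓ atTop, S (r + 1 / S r) < 2 * S r := by
  -- Cut the exceptional set at the dyadic levels of `S`. If `x`, `y` lie in one piece, then `y < x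
  -- + 1 / S x`, since beyond that point `S` has left the level; so the piece has diameter at most
  -- `2 ^ (-k)`.
  set E : ℕ → Set ℝ := fun k ↦
    {r | r₀ ≤ r ∧ 2 * S r ≤ S (r + 1 / S r) ∧ 2 ^ k ≤ S r ∧ S r < 2 ^ (k + 1)} with hE
  have hsub : ∀ k, ∀ x ∈ E k, ∀ y ∈ E k, y ≤ x + (1 / 2) ^ k := by
    rintro k x ⟨hx0, hx1, hx2, hx3⟩ y ⟨hy0, hy1, hy2, hy3⟩
    have hpos : 0 < 1 / S x := by have := h1 x hx0; positivity
    have hlt : y < x + 1 / S x := by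
      by_contra! hcon
      have := hS (Set.mem_Ici.2 (by linarith)) hy0 hcon
      have h4 : (2 : ℝ) ^ (k + 1) = 2 * 2 ^ k := by ring
      linarith
    have : 1 / S x ≤ (1 / 2) ^ k := by
      rw [one_div_pow]
      gcongr
    linarith
  have hvol : ∀ k, volume (E k) ≤ ENNReal.ofReal ((1 / 2) ^ k) := fun k ↦ by
    refine (Real.volume_le_diam _).trans (Metric.ediam_le fun x hx y hy ↦ ?_)
    rw [edist_dist, Real.dist_eq]
    refine ENNReal.ofReal_le_ofReal (abs_le.2 ⟨?_, ?_⟩)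
    · linarith [hsub k x hx y hy]
    · linarith [hsub k y hy x hx]
  have hfin : volume (⋃ k, E k) < ⊤ := by
    refine (measure_iUnion_le E).trans_lt ((ENNReal.tsum_le_tsum hvol).trans_lt ?_)
    rw [← ENNReal.ofReal_tsum_of_nonneg (fun _ ↦ by positivity) summable_geometric_two]
    exact ENNReal.ofReal_lt_top
  have hc : (⋃ k, E k)ᶜ ∈ (volume : Measure ℝ).cofinite := Measure.compl_mem_cofinite.2 hfin
  filter_upwards [mem_inf_of_left hc, mem_inf_of_right (Ici_mem_atTop r₀)] with r hr hr0
  by_contra! hcon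
  obtain ⟨k, hk1, hk2⟩ := exists_nat_pow_near (h1 r hr0) one_lt_two
  exact hr (Set.mem_iUnion.2 ⟨k, hr0, hcon, hk1, hk2⟩)

/-! ### Zeros, poles and the zero-free factor on a disc -/

open Function.locallyFinsuppWithin in
/-- A finite part of an effective divisor bounds its logarithmic counting function from below. -/
theorem sum_mul_log_sub_log_le_logCounting {D : Function.locallyFinsupp ℂ ℤ} (hD : 0 ≤ D)
    {s : Finset ℂ} {r : ℝ} (hr : 1 ≤ r) (hs : ∀ u ∈ s, ‖u‖ ≤ r) :
    ∑ u ∈ s, (D u : ℝ) * (Real.log r - Real.log ‖u‖) ≤ logCounting D r := by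
  classical
  have hle : ∑ u ∈ s, single u (D u) ≤ D := by
    intro z
    have : (∑ u ∈ s, single u (D u) : Function.locallyFinsupp ℂ ℤ) z =
        if z ∈ s then D z else 0 := by
      rw [Function.locallyFinsuppWithin.coe_sum, Finset.sum_apply]
      simp [single_apply]
    rw [this]
    split_ifs
    · exact le_rfl
    · exact hD z
  refine le_trans (le_of_eq ?_) (logCounting_le hle hr)
  rw [map_sum, Finset.sum_apply]
  exact Finset.sum_congr rfl fun u hu ↦ (logCounting_single_eq_log_sub_const (hs u hu)).symm

-- If `x ≤ M` and `0 ≤ M`, then `|x| ≤ 2 M - x`. Take `M = log (2 R)`; the mean of `log ‖z - u‖` is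
-- `log R ≥ 0`.
open Real Metric in
theorem circleAverage_abs_log_norm_sub_le {R : ℝ} (hR : 1 ≤ R) {u : ℂ} (hu : ‖u‖ ≤ R) :
    circleAverage (fun z ↦ |log ‖z - u‖|) 0 R ≤ 2 * log (2 * R) := by
  have hR0 : 0 < R := by linarith
  have hint := circleIntegrable_log_norm_sub_const (a := u) (c := 0) R
  have hlog0 : 0 ≤ log (2 * R) := log_nonneg (by linarith)
  have h1 : ∀ z ∈ sphere (0 : ℂ) |R|, |log ‖z - u‖| ≤ 2 * log (2 * R) - log ‖z - u‖ := by
    intro z hz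
    rw [mem_sphere_zero_iff_norm, abs_of_pos hR0] at hz
    have h2 : log ‖z - u‖ ≤ log (2 * R) := by
      rcases eq_or_ne (z - u) 0 with h | h
      · simpa [h] using hlog0
      · exact log_le_log (norm_pos_iff.2 h) ((norm_sub_le _ _).trans (by linarith))
    rcases abs_cases (log ‖z - u‖) with h | h <;> linarith
  have hc := circleIntegrable_const (2 * log (2 * R)) (0 : ℂ) R
  refine (circleAverage_mono hint.abs (hc.sub hint) h1).trans ?_
  rw [circleAverage_sub hc hint, circleAverage_const,
    circleAverage_log_norm_sub_const_of_mem_closedBall (by simpa [abs_of_pos hR0] using hu)]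
  linarith [log_nonneg hR]

open Real ValueDistribution in
theorem circleAverage_abs_log_norm_eq_proximity_add_proximity_inv {f : ℂ → ℂ} (hf : Meromorphic f)
    (R : ℝ) :
    circleAverage (fun z ↦ |log ‖f z‖|) 0 R = proximity f ⊤ R + proximity f⁻¹ ⊤ R := by
  rw [proximity_top, proximity_top,
    ← circleAverage_add hf.meromorphicOn.circleIntegrable_posLog_norm
    hf.inv.meromorphicOn.circleIntegrable_posLog_norm]
  congr 1
  ext z
  simp only [Pi.add_apply, Pi.inv_apply, norm_inv, posLog_apply, log_inv]
  rcases abs_cases (log ‖f z‖) with h | h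
  · rw [max_eq_right h.2, max_eq_left (by linarith)]; linarith
  · rw [max_eq_left h.2.le, max_eq_right (by linarith)]; linarith

open Real ValueDistribution Metric in
/-- Mean of `|log ‖g‖|` for the zero-free factor `g` of a meromorphic function. -/
theorem circleAverage_abs_log_norm_zeroFree_factor_le {f g : ℂ → ℂ} {s : Finset ℂ} {D : ℂ → ℤ}
    {R : ℝ} (hR : 1 ≤ R) (hs : ∀ u ∈ s, ‖u‖ ≤ R) (hf : Meromorphic f)
    (hg : AnalyticOnNhd ℂ g (closedBall 0 R)) (hg0 : ∀ z ∈ closedBall 0 R, g z ≠ 0)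
    (h : f =ᶠ[codiscreteWithin (closedBall 0 R)] fun z ↦ (∏ u ∈ s, (z - u) ^ D u) * g z) :
    circleAverage (fun z ↦ |log ‖g z‖|) 0 R ≤
      proximity f ⊤ R + proximity f⁻¹ ⊤ R + (∑ u ∈ s, |(D u : ℝ)|) * (2 * log (2 * R)) := by
  have hR0 : 0 < R := by linarith
  have hsph : sphere (0 : ℂ) |R| ⊆ closedBall 0 R := by
    rw [abs_of_pos hR0]; exact sphere_subset_closedBall
  have hgi : CircleIntegrable (fun z ↦ log ‖g z‖) 0 R :=
    MeromorphicOn.circleIntegrable_log_norm (fun z hz ↦ (hg z (hsph hz)).meromorphicAt)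
  have hfi : CircleIntegrable (fun z ↦ log ‖f z‖) 0 R :=
    hf.meromorphicOn.circleIntegrable_log_norm
  have hui : ∀ u, CircleIntegrable (fun z ↦ |log ‖z - u‖|) 0 R := fun u ↦
    (circleIntegrable_log_norm_sub_const (a := u) R).abs
  have hui' : ∀ u, CircleIntegrable (fun z ↦ |(D u : ℝ)| * |log ‖z - u‖|) 0 R := fun u ↦
    (hui u).const_mul _
  have hsi : CircleIntegrable (fun z ↦ ∑ u ∈ s, |(D u : ℝ)| * |log ‖z - u‖|) 0 R :=
    CircleIntegrable.fun_sum _ fun u _ ↦ hui' u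
  set L : ℂ → ℝ := fun z ↦ log ‖f z‖ - ∑ u ∈ s, (D u : ℝ) * log ‖z - u‖ with hL
  have hLi : CircleIntegrable L 0 R := hfi.sub
    (CircleIntegrable.fun_sum _ fun u _ ↦
      (circleIntegrable_log_norm_sub_const (a := u) R).const_mul _)
  have hcong : (fun z ↦ |log ‖g z‖|) =ᶠ[codiscreteWithin (sphere 0 |R|)] fun z ↦ |L z| := by
    filter_upwards [h.filter_mono (codiscreteWithin_mono hsph),
      compl_finite_mem_codiscreteWithin s.finite_toSet,
      self_mem_codiscreteWithin (sphere (0 : ℂ) |R|)] with z hz hzs hzR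
    have hne : ∀ u ∈ s, (z - u) ^ D u ≠ 0 := fun u hu ↦
      zpow_ne_zero _ (sub_ne_zero.2 fun hzu ↦ hzs (by simpa [hzu] using hu))
    have : log ‖f z‖ = ∑ u ∈ s, (D u : ℝ) * log ‖z - u‖ + log ‖g z‖ := by
      rw [hz, norm_mul, log_mul (norm_ne_zero_iff.2 (Finset.prod_ne_zero_iff.2 hne))
        (norm_ne_zero_iff.2 (hg0 z (hsph hzR))), norm_prod,
        log_prod fun u hu ↦ norm_ne_zero_iff.2 (hne u hu)]
      simp [norm_zpow, log_zpow]
    rw [hL]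
    simp only [this]
    congr 1; ring
  rw [circleAverage_congr_codiscreteWithin hcong hR0.ne']
  have hle : ∀ z ∈ sphere (0 : ℂ) |R|, |L z| ≤
      |log ‖f z‖| + ∑ u ∈ s, |(D u : ℝ)| * |log ‖z - u‖| := by
    intro z _
    refine (abs_sub _ _).trans (add_le_add le_rfl ((Finset.abs_sum_le_sum_abs _ _).trans_eq ?_))
    simp [abs_mul]
  refine (circleAverage_mono (f₂ := fun z ↦ |log ‖f z‖| + ∑ u ∈ s, |(D u : ℝ)| * |log ‖z - u‖|)
    hLi.abs (hfi.abs.add hsi) hle).trans ?_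
  have hfi' : CircleIntegrable (fun z ↦ |log ‖f z‖|) 0 R := hfi.abs
  refine (circleAverage_fun_add hfi' hsi).trans_le ?_
  rw [← circleAverage_abs_log_norm_eq_proximity_add_proximity_inv hf,
    circleAverage_fun_sum fun u _ ↦ hui' u, Finset.sum_mul]
  refine add_le_add le_rfl (Finset.sum_le_sum fun u hu ↦ ?_)
  have := circleAverage_fun_smul (a := |(D u : ℝ)|) (f := fun z ↦ |log ‖z - u‖|) (c := 0) (R := R)
  simp only [smul_eq_mul] at this
  rw [this]
  exact mul_le_mul_of_nonneg_left (circleAverage_abs_log_norm_sub_le hR (hs u hu)) (abs_nonneg _)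

open ValueDistribution Function.locallyFinsuppWithin in
theorem logCounting_abs_divisor (f : ℂ → ℂ) :
    logCounting |MeromorphicOn.divisor f Set.univ| =
      ValueDistribution.logCounting f 0 + ValueDistribution.logCounting f ⊤ := by
  rw [logCounting_zero, logCounting_top, ← map_add, posPart_add_negPart]

namespace ValueDistribution

theorem logCounting_top_le_characteristic (f : ℂ → ℂ) (r : ℝ) :
    logCounting f ⊤ r ≤ characteristic f ⊤ r := by
  have : 0 ≤ proximity f ⊤ r := proximity_nonneg r
  simp only [characteristic, Pi.add_apply]
  linarith

theorem proximity_top_le_characteristic (f : ℂ → ℂ) {r : ℝ} (hr : 1 ≤ r) :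
    proximity f ⊤ r ≤ characteristic f ⊤ r := by
  have := logCounting_nonneg (f := f) (e := ⊤) hr
  simp only [characteristic, Pi.add_apply]
  linarith

theorem exists_characteristic_inv_le {f : ℂ → ℂ} (hf : Meromorphic f) :
    ∃ B : ℝ, 0 ≤ B ∧ ∀ r, characteristic f⁻¹ ⊤ r ≤ characteristic f ⊤ r + B := by
  refine ⟨max |Real.log ‖f 0‖| |Real.log ‖meromorphicTrailingCoeffAt f 0‖|,
    le_max_of_le_left (abs_nonneg _), fun r ↦ ?_⟩
  have := (abs_le.1 (characteristic_sub_characteristic_inv_le (R := r) hf)).1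
  linarith

end ValueDistribution

open ValueDistribution in
/-- The number of zeros and poles in a disc is controlled by the characteristic on a larger one. -/
theorem sum_abs_divisor_le {f : ℂ → ℂ} {s : Finset ℂ} {R R' : ℝ} (hR : 1 ≤ R) (hRR' : R < R')
    (hs : ∀ u ∈ s, ‖u‖ ≤ R) :
    ∑ u ∈ s, |(MeromorphicOn.divisor f Set.univ u : ℝ)| ≤
      R' / (R' - R) * (characteristic f ⊤ R' + characteristic f⁻¹ ⊤ R') := by
  have hR0 : 0 < R := by linarith
  have hR'0 : 0 < R' := by linarith
  have hd : 0 < R' - R := by linarith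
  have h1 := sum_mul_log_sub_log_le_logCounting (D := |MeromorphicOn.divisor f Set.univ|)
    (abs_nonneg _) (s := s) (r := R') (by linarith) fun u hu ↦ (hs u hu).trans hRR'.le
  rw [logCounting_abs_divisor] at h1
  have h2 : ValueDistribution.logCounting f 0 R' + ValueDistribution.logCounting f ⊤ R' ≤
      characteristic f ⊤ R' + characteristic f⁻¹ ⊤ R' := by
    rw [← logCounting_inv]
    linarith [logCounting_top_le_characteristic f R', logCounting_top_le_characteristic f⁻¹ R']
  -- Each point of modulus at most `R` weighs at least `log (R' / R) ≥ (R' - R) / R'` in the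
  -- counting function at `R'`.
  have h5 : (∑ u ∈ s, |(MeromorphicOn.divisor f Set.univ u : ℝ)|) * ((R' - R) / R') ≤
      characteristic f ⊤ R' + characteristic f⁻¹ ⊤ R' := by
    refine le_trans ?_ (h1.trans h2)
    rw [Finset.sum_mul]
    refine Finset.sum_le_sum fun u hu ↦ ?_
    have hlog : Real.log ‖u‖ ≤ Real.log R := by
      rcases eq_or_ne u 0 with h | h
      · simpa [h] using Real.log_nonneg hR
      · exact Real.log_le_log (norm_pos_iff.2 h) (hs u hu)
    have h6 : (R' - R) / R' ≤ Real.log R' - Real.log R := by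
      have := Real.log_le_sub_one_of_pos (div_pos hR0 hR'0)
      rw [Real.log_div hR0.ne' hR'0.ne'] at this
      rw [sub_div, div_self hR'0.ne']
      linarith
    have h7 : ((|MeromorphicOn.divisor f Set.univ| u : ℤ) : ℝ) =
      |(MeromorphicOn.divisor f Set.univ u : ℝ)| := by
      rw [← Int.cast_abs]; rfl
    rw [h7]
    exact mul_le_mul_of_nonneg_left (by linarith) (abs_nonneg _)
  rw [← le_div_iff₀ (by positivity)] at h5
  refine h5.trans_eq ?_
  field_simp

/-! ### Proximity functions of logarithmic derivatives -/

theorem Real.sqrt_add_le_add_sqrt {x y : ℝ} (hx : 0 ≤ x) (hy : 0 ≤ y) : √(x + y) ≤ √x + √y := by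
  rw [Real.sqrt_le_left (by positivity)]
  nlinarith [Real.sq_sqrt hx, Real.sq_sqrt hy, Real.sqrt_nonneg x, Real.sqrt_nonneg y,
    mul_nonneg (Real.sqrt_nonneg x) (Real.sqrt_nonneg y)]

theorem Real.sqrt_sum_le_sum_sqrt {ι : Type*} (s : Finset ι) {x : ι → ℝ} (hx : ∀ i, 0 ≤ x i) :
    √(∑ i ∈ s, x i) ≤ ∑ i ∈ s, √(x i) := by
  classical
  induction s using Finset.induction_on with
  | empty => simp
  | insert a s ha ih =>
    rw [Finset.sum_insert ha, Finset.sum_insert ha]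
    exact (Real.sqrt_add_le_add_sqrt (hx a) (Finset.sum_nonneg fun i _ ↦ hx i)).trans
      (add_le_add le_rfl ih)

-- Square roots make the poles integrable on circles: `log⁺ x ≤ 2 log (1 + √x)`, the root is
-- subadditive, the mean of `‖z - u‖ ^ (-1/2)` is bounded uniformly in `u`, and concavity of `log`
-- brings the mean inside.
open Real ValueDistribution Metric in
theorem exists_proximity_sum_div_sub_add_le :
    ∃ C : ℝ, 0 ≤ C ∧ ∀ (h p : ℂ → ℂ) (s : Finset ℂ) (D : ℂ → ℤ) (r K : ℝ), Meromorphic h → 1 ≤ r →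
      (∀ z ∈ sphere 0 r, ‖p z‖ ≤ K) →
      (h =ᶠ[codiscreteWithin (sphere 0 r)] fun z ↦ ∑ u ∈ s, D u / (z - u) + p z) →
      proximity h ⊤ r ≤ 2 * log (1 + (∑ u ∈ s, |(D u : ℝ)|) * C + √K) := by
  obtain ⟨C, hC, H⟩ := exists_circleAverage_inv_sqrt_norm_sub_le
  refine ⟨C, hC, fun h p s D r K hh hr hp heq ↦ ?_⟩
  have hr0 : 0 < r := by linarith
  set A : ℝ := 1 + (∑ u ∈ s, |(D u : ℝ)|) * C + √K with hA
  have hA1 : 1 ≤ A := by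
    have : 0 ≤ (∑ u ∈ s, |(D u : ℝ)|) * C :=
      mul_nonneg (Finset.sum_nonneg fun _ _ ↦ abs_nonneg _) hC
    linarith [sqrt_nonneg K]
  have hA0 : 0 < A := by linarith
  set B : ℂ → ℝ := fun z ↦ ∑ u ∈ s, |(D u : ℝ)| * (√‖z - u‖)⁻¹ with hB
  have hui : ∀ u, CircleIntegrable (fun z ↦ |(D u : ℝ)| * (√‖z - u‖)⁻¹) 0 r := fun u ↦
    (H r hr0 u).1.const_mul _
  have hBi : CircleIntegrable B 0 r := CircleIntegrable.fun_sum _ fun u _ ↦ hui u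
  have hBavg : circleAverage B 0 r ≤ (∑ u ∈ s, |(D u : ℝ)|) * C := by
    rw [hB, circleAverage_fun_sum fun u _ ↦ hui u, Finset.sum_mul]
    refine Finset.sum_le_sum fun u _ ↦ ?_
    have h1 := circleAverage_fun_smul (a := |(D u : ℝ)|) (f := fun z ↦ (√‖z - u‖)⁻¹)
      (c := 0) (R := r)
    simp only [smul_eq_mul] at h1
    rw [h1]
    refine mul_le_mul_of_nonneg_left ((H r hr0 u).2.trans ?_) (abs_nonneg _)
    exact div_le_self hC (one_le_sqrt.2 hr)
  set q : ℂ → ℂ := fun z ↦ ∑ u ∈ s, D u / (z - u) + p z with hq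
  have hsph : sphere (0 : ℂ) |r| = sphere 0 r := by rw [abs_of_pos hr0]
  rw [← hsph] at heq hp
  have hqi : CircleIntegrable (fun z ↦ log⁺ ‖q z‖) 0 r := by
    refine CircleIntegrable.congr_codiscreteWithin (f₁ := fun z ↦ log⁺ ‖h z‖) ?_
      hh.meromorphicOn.circleIntegrable_posLog_norm
    filter_upwards [heq] with z hz
    rw [hz]
  rw [proximity_congr_codiscreteWithin heq hr0.ne', proximity_top]
  -- Twice the tangent line of `log` at `A`, evaluated at `1 + B z + √K`. As `A` bounds the mean of
  -- the latter, the mean of `M` is at most `2 log A`.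
  set M : ℂ → ℝ := fun z ↦ 2 * (log A + (1 + √K) / A - 1) + 2 / A * B z with hM
  have hci := circleIntegrable_const (2 * (log A + (1 + √K) / A - 1)) (0 : ℂ) r
  have hle : ∀ z ∈ sphere (0 : ℂ) |r|, log⁺ ‖q z‖ ≤ M z := by
    intro z hz
    have hB0 : 0 ≤ B z := Finset.sum_nonneg fun u _ ↦ by positivity
    have h1 : √‖q z‖ ≤ B z + √K := by
      have h2 : ‖q z‖ ≤ ∑ u ∈ s, |(D u : ℝ)| / ‖z - u‖ + K := by
        refine (norm_add_le _ _).trans (add_le_add ((norm_sum_le _ _).trans_eq ?_) (hp z hz))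
        simp
      have hK : 0 ≤ K := (norm_nonneg _).trans (hp z hz)
      refine (sqrt_le_sqrt h2).trans ((Real.sqrt_add_le_add_sqrt (Finset.sum_nonneg fun u _ ↦
        by positivity) hK).trans (add_le_add ?_ le_rfl))
      refine (Real.sqrt_sum_le_sum_sqrt s fun u ↦ by positivity).trans
        (Finset.sum_le_sum fun u _ ↦ ?_)
      rw [sqrt_div (abs_nonneg _), div_eq_mul_inv]
      refine mul_le_mul_of_nonneg_right ?_ (by positivity)
      rcases eq_or_ne (D u) 0 with h0 | h0
      · simp [h0]
      · rw [sqrt_le_left (abs_nonneg _)]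
        have : (1 : ℝ) ≤ |(D u : ℝ)| := by
          rw [← Int.cast_abs]; exact_mod_cast Int.one_le_abs h0
        nlinarith
    have h3 : log⁺ ‖q z‖ ≤ 2 * log (1 + √‖q z‖) := by
      rw [posLog_apply]
      refine max_le (mul_nonneg (by norm_num) (log_nonneg (by linarith [sqrt_nonneg ‖q z‖]))) ?_
      rcases eq_or_ne ‖q z‖ 0 with h0 | h0
      · simp [h0]
      · rw [← log_rpow (by positivity), rpow_two]
        refine log_le_log (by positivity) ?_
        nlinarith [sq_sqrt (norm_nonneg (q z)), sqrt_nonneg ‖q z‖]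
    have h4 : log (1 + √‖q z‖) ≤ log A + (1 + (B z + √K)) / A - 1 := by
      have h5 : 0 < 1 + (B z + √K) := by positivity
      have h6 := log_le_sub_one_of_pos (div_pos h5 hA0)
      rw [log_div h5.ne' hA0.ne'] at h6
      have h7 : log (1 + √‖q z‖) ≤ log (1 + (B z + √K)) :=
        log_le_log (by positivity) (by linarith)
      linarith
    have h8 : M z = 2 * (log A + (1 + (B z + √K)) / A - 1) := by
      simp only [hM]; field_simp; ring
    rw [h8]; linarith
  have hBi' : CircleIntegrable (fun z ↦ 2 / A * B z) 0 r := hBi.const_mul _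
  have hMi : CircleIntegrable M 0 r := hci.add hBi'
  refine (circleAverage_mono hqi hMi hle).trans ?_
  have h9 := circleAverage_fun_smul (a := 2 / A) (f := B) (c := 0) (R := r)
  simp only [smul_eq_mul] at h9
  rw [hM, circleAverage_fun_add hci hBi', circleAverage_const, h9]
  have h10 : 2 / A * circleAverage B 0 r ≤ 2 / A * (A - (1 + √K)) := by
    refine mul_le_mul_of_nonneg_left ?_ (by positivity)
    linarith
  have h11 : 2 / A * (A - (1 + √K)) = 2 * (1 - (1 + √K) / A) := by field_simp
  linarith

/-- Splitting off the zeros and poles in a set in which there are only finitely many of them. -/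
theorem Meromorphic.exists_eventuallyEq_prod_zpow_mul {f : ℂ → ℂ} (hf : Meromorphic f)
    (hf0 : ∀ z, meromorphicOrderAt f z ≠ ⊤) {U : Set ℂ}
    (hU : (MeromorphicOn.divisor f U).support.Finite) :
    ∃ (s : Finset ℂ) (g : ℂ → ℂ), (∀ u ∈ s, u ∈ U) ∧ AnalyticOnNhd ℂ g U ∧ (∀ z ∈ U, g z ≠ 0) ∧
      f =ᶠ[codiscreteWithin U]
        fun z ↦ (∏ u ∈ s, (z - u) ^ MeromorphicOn.divisor f Set.univ u) * g z := by
  obtain ⟨g, hg, hg0, heq⟩ := MeromorphicOn.extract_zeros_poles (U := U) hf.meromorphicOn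
    (fun u ↦ hf0 u) hU
  have hmem : ∀ u ∈ hU.toFinset, u ∈ U := fun u hu ↦
    (MeromorphicOn.divisor f U).supportWithinDomain (hU.mem_toFinset.1 hu)
  refine ⟨hU.toFinset, g, hmem, hg, fun z hz ↦ hg0 ⟨z, hz⟩, ?_⟩
  filter_upwards [heq] with z hz
  rw [hz, Pi.smul_apply', smul_eq_mul, Function.FactorizedRational.finprod_eq_fun hU]
  beta_reduce
  rw [finprod_eq_prod_of_mulSupport_subset (s := hU.toFinset)]
  · congr 1
    refine Finset.prod_congr rfl fun u hu ↦ ?_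
    rw [MeromorphicOn.divisor_apply hf.meromorphicOn (hmem u hu),
      MeromorphicOn.divisor_apply hf.meromorphicOn (Set.mem_univ u)]
  · intro u hu
    rw [Set.Finite.coe_toFinset, Function.mem_support]
    intro h0
    exact hu (by simp [h0])

open Metric in
theorem logDeriv_eventuallyEq_sum_div_add {f g : ℂ → ℂ} {s : Finset ℂ} {D : ℂ → ℤ} {R : ℝ}
    (hg : AnalyticOnNhd ℂ g (closedBall 0 R)) (hg0 : ∀ z ∈ closedBall 0 R, g z ≠ 0)
    (h : f =ᶠ[codiscreteWithin (closedBall 0 R)] fun z ↦ (∏ u ∈ s, (z - u) ^ D u) * g z) :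
    logDeriv f =ᶠ[codiscreteWithin (ball 0 R)]
      fun z ↦ ∑ u ∈ s, D u / (z - u) + logDeriv g z := by
  have h1 := logDeriv_congr_codiscreteWithin isOpen_ball
    (h.filter_mono (codiscreteWithin_mono ball_subset_closedBall))
  filter_upwards [h1, compl_finite_mem_codiscreteWithin s.finite_toSet,
    self_mem_codiscreteWithin (ball (0 : ℂ) R)] with z hz hzs hzR
  have hzu : ∀ u ∈ s, z - u ≠ 0 := fun u hu ↦
    sub_ne_zero.2 fun hzu ↦ hzs (by simpa [hzu] using hu)
  have hd : ∀ u ∈ s, DifferentiableAt ℂ (fun z ↦ (z - u) ^ D u) z := fun u hu ↦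
    DifferentiableAt.zpow (by fun_prop) (Or.inl (hzu u hu))
  have hne : ∀ u ∈ s, (z - u) ^ D u ≠ 0 := fun u hu ↦ zpow_ne_zero _ (hzu u hu)
  have hzR' := ball_subset_closedBall hzR
  rw [hz, logDeriv_mul (f := fun z ↦ ∏ u ∈ s, (z - u) ^ D u) z (Finset.prod_ne_zero_iff.2 hne)
    (hg0 z hzR') (DifferentiableAt.fun_finsetProd hd) (hg z hzR').differentiableAt,
    logDeriv_prod (f := fun u z ↦ (z - u) ^ D u) hne hd]
  congr 1
  refine Finset.sum_congr rfl fun u hu ↦ ?_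
  rw [logDeriv_fun_zpow (by fun_prop)]
  simp [logDeriv_apply, div_eq_mul_inv]

open ValueDistribution Metric in
/-- Nevanlinna's estimate for the proximity function of a logarithmic derivative. -/
theorem exists_proximity_logDeriv_le : ∃ C : ℝ, 0 ≤ C ∧ ∀ f : ℂ → ℂ, Meromorphic f →
    (∀ z, meromorphicOrderAt f z ≠ ⊤) → ∀ r R R' N : ℝ, 1 ≤ r → r < R → R < R' →
      R' / (R' - R) * (characteristic f ⊤ R' + characteristic f⁻¹ ⊤ R') ≤ N →
      proximity (logDeriv f) ⊤ r ≤ 2 * Real.log (1 + N * C + √(2 * R / (R - r) ^ 2 *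
        (proximity f ⊤ R + proximity f⁻¹ ⊤ R + N * (2 * Real.log (2 * R))))) := by
  obtain ⟨C, hC, H⟩ := exists_proximity_sum_div_sub_add_le
  refine ⟨C, hC, fun f hf hf0 r R R' N hr hrR hRR' hN ↦ ?_⟩
  obtain ⟨s, g, hs, hg, hg0, heq⟩ := hf.exists_eventuallyEq_prod_zpow_mul hf0
    ((MeromorphicOn.divisor f (closedBall 0 R)).finiteSupport (isCompact_closedBall 0 R))
  have hs' : ∀ u ∈ s, ‖u‖ ≤ R := fun u hu ↦ mem_closedBall_zero_iff.1 (hs u hu)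
  have hn := (sum_abs_divisor_le (f := f) (by linarith) hRR' hs').trans hN
  have hm := circleAverage_abs_log_norm_zeroFree_factor_le (by linarith) hs' hf hg hg0 heq
  have hsb : sphere (0 : ℂ) r ⊆ ball 0 R := sphere_subset_ball hrR
  have hlog : 0 ≤ Real.log (2 * R) := Real.log_nonneg (by linarith)
  have hd : 0 < R - r := by linarith
  have hK : ∀ z ∈ sphere (0 : ℂ) r, ‖logDeriv g z‖ ≤ 2 * R / (R - r) ^ 2 *
        (proximity f ⊤ R + proximity f⁻¹ ⊤ R + N * (2 * Real.log (2 * R))) := by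
    intro z hz
    have h1 := norm_logDeriv_le_circleAverage hg hg0 (hsb hz)
    rw [mem_sphere_zero_iff_norm.1 hz] at h1
    refine h1.trans (mul_le_mul_of_nonneg_left (hm.trans ?_) ?_)
    · gcongr
    · have : 0 < R := by linarith
      positivity
  refine (H (logDeriv f) (logDeriv g) s _ r _ ?_ hr hK
    ((logDeriv_eventuallyEq_sum_div_add hg hg0 heq).filter_mono
      (codiscreteWithin_mono hsb))).trans ?_
  · exact hf.deriv.div hf
  · have h0 : 0 ≤ ∑ u ∈ s, |(MeromorphicOn.divisor f Set.univ u : ℝ)| :=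
      Finset.sum_nonneg fun _ _ ↦ abs_nonneg _
    have : 0 ≤ (∑ u ∈ s, |(MeromorphicOn.divisor f Set.univ u : ℝ)|) * C := mul_nonneg h0 hC
    gcongr

/-! ### Exceptional sets and the lemma on the logarithmic derivative -/

/-- The filter of neighbourhoods of `+∞` up to sets of finite Lebesgue measure. -/
noncomputable def atTopModFinite : Filter ℝ := (volume : Measure ℝ).cofinite ⊓ atTop

theorem atTopModFinite_le_atTop : atTopModFinite ≤ atTop := inf_le_right

theorem eventually_atTopModFinite_of_atTop {p : ℝ → Prop} (h : ∀ᶠ r in atTop, p r) :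
    ∀ᶠ r in atTopModFinite, p r := h.filter_mono atTopModFinite_le_atTop

instance : atTopModFinite.NeBot := by
  rw [atTopModFinite, inf_neBot_iff]
  intro s hs t ht
  obtain ⟨a, ha⟩ := mem_atTop_sets.1 ht
  by_contra hne
  rw [Set.not_nonempty_iff_eq_empty] at hne
  have hsub : Set.Ici a ⊆ sᶜ := fun x hx hxs ↦ by
    have : x ∈ s ∩ t := ⟨hxs, ha x hx⟩
    rw [hne] at this
    exact this
  have := (measure_mono hsub).trans_lt (Measure.mem_cofinite.1 hs)
  simp at this

/-- Moves estimates with different exceptional sets to one common filter, where they can be added.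
-/
theorem atTopModFinite_le_inf_principal {E : Set ℝ} (hE : volume E < ⊤) :
    atTopModFinite ≤ atTop ⊓ 𝓟 Eᶜ :=
  le_inf inf_le_right (inf_le_left.trans (le_principal_iff.2 (Measure.compl_mem_cofinite.2 hE)))

/-- Bookkeeping for the radii that Borel's lemma supplies: the kernel costs `t ^ 3`, the number of
zeros and poles `t ^ 3` and `log (2 R)` one more `t`. Any power of `t` would do, as a logarithm is
taken next. -/
theorem one_add_sqrt_le_mul_pow_seven {B C t r R P : ℝ} (hB : 0 ≤ B) (hC : 0 ≤ C) (hr : 1 ≤ r)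
    (hrt : r ≤ t) (hR : R = r + 1 / (2 * t)) (hP : 0 ≤ P) (hPt : P ≤ 4 * t + B) :
    1 + (16 + 4 * B) * t ^ 3 * C +
      √(2 * R / (R - r) ^ 2 * (P + (16 + 4 * B) * t ^ 3 * (2 * Real.log (2 * R)))) ≤
    (1 + (16 + 4 * B) * C + (1 + 16 * (4 + B + (16 + 4 * B) * 8))) * t ^ 7 := by
  have ht1 : 1 ≤ t := hr.trans hrt
  have ht0 : 0 < t := by linarith
  have hhalf : 1 / (2 * t) ≤ 1 := by rw [div_le_one (by linarith)]; linarith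
  have hhalf0 : 0 < 1 / (2 * t) := by positivity
  have hR1 : 1 ≤ R := by linarith
  have hRt : R ≤ 2 * t := by linarith
  have hlog : 0 ≤ Real.log (2 * R) := Real.log_nonneg (by linarith)
  have hlog2R : Real.log (2 * R) ≤ 4 * t := by
    have := Real.log_le_sub_one_of_pos (show 0 < 2 * R by linarith)
    linarith
  have hin : P + (16 + 4 * B) * t ^ 3 * (2 * Real.log (2 * R)) ≤
      (4 + B + (16 + 4 * B) * 8) * t ^ 4 := by
    have h5 : 4 * t + B ≤ (4 + B) * t ^ 4 := by
      have h6 : t ≤ t ^ 4 := le_self_pow₀ ht1 (by norm_num)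
      have h7 : 1 ≤ t ^ 4 := one_le_pow₀ ht1
      nlinarith
    have h8 : (16 + 4 * B) * t ^ 3 * (2 * Real.log (2 * R)) ≤
        (16 + 4 * B) * t ^ 3 * (2 * (4 * t)) := by gcongr
    have h9 : (16 + 4 * B) * t ^ 3 * (2 * (4 * t)) = (16 + 4 * B) * 8 * t ^ 4 := by ring
    linarith
  have hK : 2 * R / (R - r) ^ 2 ≤ 16 * t ^ 3 := by
    have h2 : R - r = 1 / (2 * t) := by rw [hR, add_sub_cancel_left]
    rw [h2, div_pow, one_pow, div_div_eq_mul_div, div_one, mul_pow]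
    have := mul_le_mul_of_nonneg_right hRt (sq_nonneg t)
    linarith [pow_succ t 2]
  have hKtot : 2 * R / (R - r) ^ 2 * (P + (16 + 4 * B) * t ^ 3 * (2 * Real.log (2 * R))) ≤
      16 * (4 + B + (16 + 4 * B) * 8) * t ^ 7 := by
    calc _ ≤ 16 * t ^ 3 * ((4 + B + (16 + 4 * B) * 8) * t ^ 4) :=
        mul_le_mul hK hin (by positivity) (by positivity)
      _ = _ := by ring
  have h7 : 1 ≤ t ^ 7 := one_le_pow₀ ht1
  have h3 : t ^ 3 ≤ t ^ 7 := pow_le_pow_right₀ ht1 (by norm_num)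
  have hsq : ∀ x : ℝ, 0 ≤ x → √x ≤ 1 + x := fun x hx ↦ by
    rw [Real.sqrt_le_left (by linarith)]; nlinarith
  have h4 := (Real.sqrt_le_sqrt hKtot).trans (hsq _ (by positivity))
  have h5 : (16 + 4 * B) * C * t ^ 3 ≤ (16 + 4 * B) * C * t ^ 7 :=
    mul_le_mul_of_nonneg_left h3 (by positivity)
  linarith

open ValueDistribution Metric in
/-- The **lemma on the logarithmic derivative**. -/
theorem proximity_logDeriv_isBigO_log {f : ℂ → ℂ} (hf : Meromorphic f)
    (hf0 : ∀ z, meromorphicOrderAt f z ≠ ⊤) :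
    proximity (logDeriv f) ⊤ =O[atTopModFinite]
      fun r ↦ Real.log (characteristic f ⊤ r + r) := by
  obtain ⟨C, hC, H⟩ := exists_proximity_logDeriv_le
  set S : ℝ → ℝ := fun r ↦ characteristic f ⊤ r + r with hS
  have hSge : ∀ r, 1 ≤ r → r ≤ S r := fun r hr ↦ by
    have := characteristic_nonneg (f := f) (a := ⊤) hr
    simp only [hS]; linarith
  have hSmono : MonotoneOn S (Set.Ici 1) := fun x hx y hy hxy ↦ by
    have hx' : 0 < x := lt_of_lt_of_le one_pos hx
    exact add_le_add (characteristic_monotoneOn hf hx' (hx'.trans_le hxy) hxy) hxy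
  obtain ⟨B, hB0, hinv⟩ := exists_characteristic_inv_le hf
  set c : ℝ := 1 + (16 + 4 * B) * C + (1 + 16 * (4 + B + (16 + 4 * B) * 8)) with hc
  have hc1 : 1 ≤ c := by
    have : 0 ≤ (16 + 4 * B) * C := by positivity
    linarith
  -- `2 log (c t ^ 7) = 2 log c + 14 log t`, and `r ≥ e` forces `log t ≥ 1`, which absorbs the
  -- constant term.
  refine IsBigO.of_bound (2 * Real.log c + 14) ?_
  filter_upwards [eventually_lt_two_mul_of_monotoneOn hSmono fun r hr ↦ hr.trans (hSge r hr),
    eventually_atTopModFinite_of_atTop (eventually_ge_atTop (Real.exp 1))] with r hr hre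
  have hr1 : 1 ≤ r := le_trans (by linarith [Real.add_one_le_exp 1]) hre
  have hsr := hSge r hr1
  set t := S r with ht
  have ht1 : 1 ≤ t := hr1.trans hsr
  have ht0 : 0 < t := by linarith
  have hinvt : 1 / t ≤ 1 := by rw [div_le_one ht0]; exact ht1
  have hinvt0 : 0 < 1 / t := by positivity
  -- Borel's step `1 / t` is halved: `r < R` separates the circle from the boundary of the disc, `R
  -- < R'` allows zeros and poles to be counted.
  set R := r + 1 / (2 * t) with hR
  set R' := r + 1 / t with hR'
  have hhalf : 1 / (2 * t) = 1 / t / 2 := by rw [div_div, mul_comm]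
  have hrR : r < R := by rw [hR, hhalf]; linarith
  have hRR' : R < R' := by rw [hR, hR', hhalf]; linarith
  have hR't : R' ≤ 2 * t := by linarith
  have hTR' : characteristic f ⊤ R' ≤ 2 * t := by
    have : characteristic f ⊤ R' + R' < 2 * t := hr
    linarith
  have hTR : characteristic f ⊤ R ≤ 2 * t := by
    refine le_trans (characteristic_monotoneOn hf ?_ ?_ hRR'.le) hTR' <;>
      exact Set.mem_Ioi.2 (by linarith)
  have hm := proximity_top_le_characteristic f (r := R) (by linarith)
  have hm' := proximity_top_le_characteristic f⁻¹ (r := R) (by linarith)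
  have hd1 : R' / (R' - R) ≤ 4 * t ^ 2 := by
    have h2 : R' - R = 1 / (2 * t) := by rw [hR, hR', hhalf]; linarith
    rw [h2, div_div_eq_mul_div, div_one]
    nlinarith
  have hN : R' / (R' - R) * (characteristic f ⊤ R' + characteristic f⁻¹ ⊤ R') ≤
      (16 + 4 * B) * t ^ 3 := by
    have h0 : 0 ≤ characteristic f ⊤ R' + characteristic f⁻¹ ⊤ R' := add_nonneg
      (characteristic_nonneg (by linarith)) (characteristic_nonneg (by linarith))
    have h3 : characteristic f ⊤ R' + characteristic f⁻¹ ⊤ R' ≤ 4 * t + B := by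
      linarith [hinv R']
    calc _ ≤ 4 * t ^ 2 * (4 * t + B) := mul_le_mul hd1 h3 h0 (by positivity)
      _ ≤ 4 * t ^ 2 * (4 * t + B * t) := by
        gcongr; nlinarith
      _ = _ := by ring
  have hmain := H f hf hf0 r R R' _ hr1 hrR hRR' hN
  have hP0 : 0 ≤ proximity f ⊤ R + proximity f⁻¹ ⊤ R :=
    add_nonneg (proximity_nonneg R) (proximity_nonneg R)
  have hA := one_add_sqrt_le_mul_pow_seven hB0 hC hr1 hsr hR hP0 (by linarith [hinv R])
  rw [← hc] at hA
  have hNC : 0 ≤ (16 + 4 * B) * t ^ 3 * C := by positivity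
  have hApos : ∀ x : ℝ, 0 < 1 + (16 + 4 * B) * t ^ 3 * C + √x := fun x ↦ by positivity
  have hfin := hmain.trans (mul_le_mul_of_nonneg_left (Real.log_le_log (hApos _) hA) zero_le_two)
  have hlogt : 1 ≤ Real.log t := by
    rw [Real.le_log_iff_exp_le ht0]; exact hre.trans hsr
  have hc0 : 0 ≤ Real.log c := Real.log_nonneg hc1
  rw [Real.log_mul (by positivity) (by positivity), Real.log_pow] at hfin
  rw [Real.norm_of_nonneg (proximity_nonneg r), Real.norm_of_nonneg (by linarith)]
  push_cast at hfin
  change _ ≤ _ * Real.log t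
  linarith [mul_nonneg hc0 (sub_nonneg.2 hlogt)]

/-! ### Identity principle, constants and polynomials -/

theorem Meromorphic.meromorphicOrderAt_ne_top {f : ℂ → ℂ} (hf : Meromorphic f) {x : ℂ}
    (hx : meromorphicOrderAt f x ≠ ⊤) (y : ℂ) : meromorphicOrderAt f y ≠ ⊤ :=
  (hf.meromorphicOn (s := Set.univ)).meromorphicOrderAt_ne_top_of_isPreconnected
    isPreconnected_univ (Set.mem_univ x) (Set.mem_univ y) hx

theorem Meromorphic.eventuallyEq_zero_of_meromorphicOrderAt_eq_top {f : ℂ → ℂ}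
    (hf : Meromorphic f) {x : ℂ} (hx : meromorphicOrderAt f x = ⊤) : f =ᶠ[codiscrete ℂ] 0 := by
  have h : ∀ y, meromorphicOrderAt f y = ⊤ := fun y ↦ by
    by_contra hy
    exact hf.meromorphicOrderAt_ne_top hy x hx
  refine mem_codiscrete.2 fun y ↦ ?_
  rw [disjoint_principal_right, compl_compl]
  exact meromorphicOrderAt_eq_top_iff.1 (h y)

theorem Meromorphic.meromorphicOrderAt_ne_top_of_not_eventuallyEq_zero {f : ℂ → ℂ}
    (hf : Meromorphic f) (h : ¬ f =ᶠ[codiscrete ℂ] 0) (x : ℂ) : meromorphicOrderAt f x ≠ ⊤ :=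
  fun hx ↦ h (hf.eventuallyEq_zero_of_meromorphicOrderAt_eq_top hx)

theorem Meromorphic.eventually_codiscrete_ne_zero {f : ℂ → ℂ} (hf : Meromorphic f)
    (h : ∀ x, meromorphicOrderAt f x ≠ ⊤) : ∀ᶠ z in codiscrete ℂ, f z ≠ 0 :=
  (hf.meromorphicOn (s := Set.univ)).eventually_codiscreteWithin_apply_ne_zero fun x _ ↦ h x

theorem Meromorphic.eventually_codiscrete_analyticAt {f : ℂ → ℂ} (hf : Meromorphic f) :
    ∀ᶠ z in codiscrete ℂ, AnalyticAt ℂ f z :=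
  (hf.meromorphicOn (s := Set.univ)).analyticAt_mem_codiscreteWithin

theorem Filter.EventuallyEq.nhdsNE_of_codiscrete {f g : ℂ → ℂ} (h : f =ᶠ[codiscrete ℂ] g) (x : ℂ) :
    f =ᶠ[𝓝[≠] x] g := by
  have := mem_codiscrete.1 h x
  rwa [disjoint_principal_right, compl_compl] at this

theorem Meromorphic.iteratedDeriv {f : ℂ → ℂ} (hf : Meromorphic f) (n : ℕ) :
    Meromorphic (iteratedDeriv n f) := by
  rw [iteratedDeriv_eq_iterate]
  exact hf.iterated_deriv

/-- A meromorphic function with vanishing derivative is constant. -/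
theorem Meromorphic.eventuallyEq_const_of_deriv {f : ℂ → ℂ} (hf : Meromorphic f) {x : ℂ}
    (h : meromorphicOrderAt (deriv f) x = ⊤) : ∃ c : ℂ, f =ᶠ[codiscrete ℂ] fun _ ↦ c := by
  -- Differentiation lowers a nonzero finite order by one, so a vanishing derivative leaves order
  -- `0` or `⊤`. This is used for `f` and then for `f - c`, where `c` is the limit of `f` at `x`.
  have key : ∀ g : ℂ → ℂ, meromorphicOrderAt (deriv g) x = ⊤ →
      meromorphicOrderAt g x = 0 ∨ meromorphicOrderAt g x = ⊤ := by
    intro g hg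
    cases hn : meromorphicOrderAt g x with
    | top => exact Or.inr rfl
    | coe n =>
      left
      by_contra hne
      have hn0 : (n : ℂ) ≠ 0 := fun h0 ↦ hne (by rw [Int.cast_eq_zero.1 h0]; rfl)
      rw [meromorphicOrderAt_deriv_eq_sub_one hn0 hn] at hg
      exact WithTop.coe_ne_top hg
  rcases key f h with h0 | htop
  · obtain ⟨c, -, hc⟩ := tendsto_ne_zero_of_meromorphicOrderAt_eq_zero (hf x) h0
    have hsub : Meromorphic fun z ↦ f z - c := hf.sub (Meromorphic.const c)
    have hpos : 0 < meromorphicOrderAt (fun z ↦ f z - c) x := by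
      rw [← tendsto_zero_iff_meromorphicOrderAt_pos (hsub x)]
      simpa using hc.sub_const c
    have hd : deriv (fun z ↦ f z - c) = deriv f := by
      ext z; exact deriv_sub_const c
    rcases key (fun z ↦ f z - c) (by rwa [hd]) with h1 | h1
    · exact absurd h1 hpos.ne'
    · refine ⟨c, ?_⟩
      filter_upwards [hsub.eventuallyEq_zero_of_meromorphicOrderAt_eq_top h1] with z hz
      exact sub_eq_zero.1 hz
  · exact ⟨0, hf.eventuallyEq_zero_of_meromorphicOrderAt_eq_top htop⟩

theorem Polynomial.exists_derivative_eq (p : Polynomial ℂ) :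
    ∃ P : Polynomial ℂ, Polynomial.derivative P = p := by
  induction p using Polynomial.induction_on' with
  | add p q hp hq =>
    obtain ⟨P, rfl⟩ := hp
    obtain ⟨Q, rfl⟩ := hq
    exact ⟨P + Q, Polynomial.derivative_add⟩
  | monomial n a =>
    refine ⟨Polynomial.monomial (n + 1) (a / (n + 1)), ?_⟩
    have : (n : ℂ) + 1 ≠ 0 := Nat.cast_add_one_ne_zero n
    rw [Polynomial.derivative_monomial]
    push_cast
    rw [div_mul_cancel₀ _ this]

/-- A meromorphic function one of whose derivatives vanishes identically is a polynomial. -/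
theorem Meromorphic.exists_eventuallyEq_polynomial {f : ℂ → ℂ} (hf : Meromorphic f) {x : ℂ} {n : ℕ}
    (h : meromorphicOrderAt (_root_.iteratedDeriv n f) x = ⊤) :
    ∃ p : Polynomial ℂ, f =ᶠ[codiscrete ℂ] fun z ↦ p.eval z := by
  induction n generalizing f with
  | zero =>
    rw [iteratedDeriv_zero] at h
    refine ⟨0, ?_⟩
    filter_upwards [hf.eventuallyEq_zero_of_meromorphicOrderAt_eq_top h] with z hz
    simpa using hz
  | succ n ih =>
    rw [iteratedDeriv_succ'] at h
    obtain ⟨p, hp⟩ := ih hf.deriv h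
    obtain ⟨P, rfl⟩ := p.exists_derivative_eq
    have hP : Meromorphic fun z ↦ P.eval z := fun z ↦ (P.differentiable.analyticAt z).meromorphicAt
    have hd : meromorphicOrderAt (deriv (f - fun z ↦ P.eval z)) x = ⊤ := by
      rw [meromorphicOrderAt_eq_top_iff]
      have h0 : deriv (f - fun z ↦ P.eval z) =ᶠ[codiscrete ℂ] 0 := by
        filter_upwards [hp, hf.eventually_codiscrete_analyticAt] with z hz hfz
        rw [deriv_sub hfz.differentiableAt P.differentiableAt, hz, Polynomial.deriv]
        simp
      exact h0.nhdsNE_of_codiscrete x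
    obtain ⟨c, hc⟩ := (hf.sub hP).eventuallyEq_const_of_deriv hd
    refine ⟨P + Polynomial.C c, ?_⟩
    filter_upwards [hc] with z hz
    simp only [Pi.sub_apply] at hz
    rw [Polynomial.eval_add, Polynomial.eval_C, ← hz]
    ring

namespace IsTranscendentalMeromorphic

variable {f : ℂ → ℂ}

theorem meromorphicOrderAt_iteratedDeriv_ne_top (hf : IsTranscendentalMeromorphic f) (n : ℕ)
    (z : ℂ) : meromorphicOrderAt (iteratedDeriv n f) z ≠ ⊤ := fun h ↦ by
  obtain ⟨p, hp⟩ := hf.1.exists_eventuallyEq_polynomial h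
  exact hf.2 ⟨p, 1, one_ne_zero, by simpa using hp⟩

theorem meromorphicOrderAt_ne_top (hf : IsTranscendentalMeromorphic f) (z : ℂ) :
    meromorphicOrderAt f z ≠ ⊤ := by
  simpa using hf.meromorphicOrderAt_iteratedDeriv_ne_top 0 z

end IsTranscendentalMeromorphic

/-! ### Growth of transcendental functions -/

theorem exists_polynomial_prod_zpow_eq (s : Finset ℂ) (D : ℂ → ℤ) (c : ℂ) :
    ∃ p q : Polynomial ℂ, q ≠ 0 ∧
      ∀ z ∉ s, (∏ u ∈ s, (z - u) ^ D u) * c = p.eval z / q.eval z := by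
  refine ⟨(∏ u ∈ s, (Polynomial.X - Polynomial.C u) ^ (D u).toNat) * Polynomial.C c,
    ∏ u ∈ s, (Polynomial.X - Polynomial.C u) ^ (-D u).toNat,
    Finset.prod_ne_zero_iff.2 fun u _ ↦ pow_ne_zero _ (Polynomial.X_sub_C_ne_zero u),
    fun z hz ↦ ?_⟩
  simp only [Polynomial.eval_mul, Polynomial.eval_prod, Polynomial.eval_pow, Polynomial.eval_sub,
    Polynomial.eval_X, Polynomial.eval_C]
  rw [mul_div_right_comm, ← Finset.prod_div_distrib]
  congr 1
  refine Finset.prod_congr rfl fun u hu ↦ ?_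
  have hne : z - u ≠ 0 := sub_ne_zero.2 fun h ↦ hz (h ▸ hu)
  rw [← zpow_natCast, ← zpow_natCast, ← zpow_sub₀ hne, Int.toNat_sub_toNat_neg]

-- Any `n` zeros or poles force `n log r - O(1) ≤ N(r, 1/f) + N(r, f) ≤ 2 T(r, f) + O(1)`, and `n`
-- is arbitrary.
open ValueDistribution in
theorem log_isLittleO_characteristic_of_infinite {f : ℂ → ℂ} (hf : Meromorphic f)
    (hD : (MeromorphicOn.divisor f Set.univ).support.Infinite) :
    Real.log =o[atTop] characteristic f ⊤ := by
  obtain ⟨B, hB, hinv⟩ := exists_characteristic_inv_le hf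
  refine isLittleO_iff.2 fun ε hε ↦ ?_
  obtain ⟨n, hn⟩ := exists_nat_gt (4 / ε)
  obtain ⟨s, hs, hsn⟩ := hD.exists_subset_card_eq n
  set D := MeromorphicOn.divisor f Set.univ
  set K := ∑ u ∈ s, |(D u : ℝ)| * |Real.log ‖u‖| with hK
  obtain ⟨M, hM⟩ := (s.image (‖·‖)).bddAbove
  have hn0 : 0 < (n : ℝ) := (by positivity : 0 < 4 / ε).trans hn
  filter_upwards [eventually_ge_atTop 1, eventually_ge_atTop M,
    Real.tendsto_log_atTop.eventually_ge_atTop (2 * (K + B) / n)] with r hr1 hrM hlog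
  have hlog0 := Real.log_nonneg hr1
  have h1 := sum_mul_log_sub_log_le_logCounting (D := |D|) (abs_nonneg _) (s := s) (r := r) hr1
    fun u hu ↦ (hM (by simpa using ⟨u, hu, rfl⟩)).trans hrM
  have h2 : n * Real.log r - K ≤
      ∑ u ∈ s, ((|D| u : ℤ) : ℝ) * (Real.log r - Real.log ‖u‖) := by
    rw [hK, ← hsn, Finset.cast_card, Finset.sum_mul, ← Finset.sum_sub_distrib]
    refine Finset.sum_le_sum fun u hu ↦ ?_
    have h3 : ((|D| u : ℤ) : ℝ) = |(D u : ℝ)| := by rw [← Int.cast_abs]; rfl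
    have h4 : (1 : ℝ) ≤ |(D u : ℝ)| := by
      rw [← Int.cast_abs]; exact_mod_cast Int.one_le_abs (hs hu)
    rw [h3, mul_sub]
    have h5 := mul_le_mul_of_nonneg_left (le_abs_self (Real.log ‖u‖)) (abs_nonneg (D u : ℝ))
    have h6 := mul_le_mul_of_nonneg_right h4 hlog0
    linarith
  have h3 := h2.trans h1
  rw [logCounting_abs_divisor] at h3
  have h4 := logCounting_top_le_characteristic f⁻¹ r
  have h5 := logCounting_top_le_characteristic f r
  rw [logCounting_inv] at h4
  have h6 := hinv r
  simp only [Pi.add_apply] at h3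
  rw [div_le_iff₀ hn0] at hlog
  rw [Real.norm_of_nonneg hlog0, Real.norm_of_nonneg (characteristic_nonneg hr1)]
  have h7 : n * Real.log r ≤ 4 * characteristic f ⊤ r := by linarith
  have h8 : 4 ≤ ε * n := by rw [div_lt_iff₀ hε] at hn; linarith
  have h9 : 4 * Real.log r ≤ ε * n * Real.log r := mul_le_mul_of_nonneg_right h8 hlog0
  have h10 : ε * (n * Real.log r) ≤ ε * (4 * characteristic f ⊤ r) :=
    mul_le_mul_of_nonneg_left h7 hε.le
  linarith

open ValueDistribution in
/-- The characteristic of a transcendental meromorphic function grows faster than `log`. -/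
theorem IsTranscendentalMeromorphic.log_isLittleO_characteristic {f : ℂ → ℂ}
    (hf : IsTranscendentalMeromorphic f) : Real.log =o[atTop] characteristic f ⊤ := by
  by_cases hD : (MeromorphicOn.divisor f Set.univ).support.Finite
  swap
  · exact log_isLittleO_characteristic_of_infinite hf.1 hD
  obtain ⟨s, g, -, hg, hg0, heq⟩ :=
    hf.1.exists_eventuallyEq_prod_zpow_mul hf.meromorphicOrderAt_ne_top hD
  obtain ⟨B, hB, hinv⟩ := exists_characteristic_inv_le hf.1
  by_contra hlog
  rw [isLittleO_iff] at hlog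
  push Not at hlog
  obtain ⟨c, hc, hfreq⟩ := hlog
  have hgd : Differentiable ℂ g := fun z ↦ (hg z (Set.mem_univ z)).differentiableAt
  set n := ∑ u ∈ s, |(MeromorphicOn.divisor f Set.univ u : ℝ)| with hn
  have hn0 : 0 ≤ n := Finset.sum_nonneg fun _ _ ↦ abs_nonneg _
  obtain ⟨M, hM⟩ := (s.image (‖·‖)).bddAbove
  -- Along the radii where `T(r, f) ≤ c⁻¹ log r`, the Herglotz bound for `g' / g` is `O(log r / r)`.
  -- So the zero-free factor is constant and `f` would be rational.
  have hzero : ∀ w, logDeriv g w = 0 := by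
    intro w
    set h : ℝ → ℝ := fun r ↦ 8 * ((2 * c⁻¹ + 2 * n) * (Real.log r / r) +
      (B + 2 * n * Real.log 2) * r⁻¹) with hh
    have htend : Tendsto h atTop (𝓝 0) := by
      have h1 := Real.isLittleO_log_id_atTop.tendsto_div_nhds_zero
      have h2 := ((h1.const_mul (2 * c⁻¹ + 2 * n)).add
        (tendsto_inv_atTop_zero.const_mul (B + 2 * n * Real.log 2))).const_mul 8
      simpa using h2
    have hle : ∃ᶠ r in atTop, ‖logDeriv g w‖ ≤ h r := by
      refine (hfreq.and_eventually ((eventually_ge_atTop 1).and ((eventually_ge_atTop M).and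
        (eventually_gt_atTop (2 * ‖w‖))))).mono ?_
      rintro r ⟨hr, hr1, hrM, hrw⟩
      have hr0 : 0 < r := by linarith
      have hw0 := norm_nonneg w
      have hlog0 := Real.log_nonneg hr1
      rw [Real.norm_of_nonneg hlog0, Real.norm_of_nonneg (characteristic_nonneg hr1)] at hr
      have h1 := norm_logDeriv_le_circleAverage (R := r) (hg.mono (Set.subset_univ _))
        (fun z _ ↦ hg0 z (Set.mem_univ z)) (w := w) (by simpa using by linarith)
      have h2 := circleAverage_abs_log_norm_zeroFree_factor_le (R := r) (s := s) hr1
        (fun u hu ↦ (hM (by simpa using ⟨u, hu, rfl⟩)).trans hrM) hf.1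
        (hg.mono (Set.subset_univ _)) (fun z _ ↦ hg0 z (Set.mem_univ z))
        (heq.filter_mono (codiscreteWithin_mono (Set.subset_univ _)))
      rw [← hn, Real.log_mul two_ne_zero hr0.ne'] at h2
      have h3 : characteristic f ⊤ r ≤ c⁻¹ * Real.log r := by
        rw [inv_mul_eq_div, le_div_iff₀ hc]; linarith
      have h4 := proximity_top_le_characteristic f hr1
      have h5 := proximity_top_le_characteristic f⁻¹ hr1
      have h6 : Real.circleAverage (fun z ↦ |Real.log ‖g z‖|) 0 r ≤
          (2 * c⁻¹ + 2 * n) * Real.log r + (B + 2 * n * Real.log 2) := by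
        refine h2.trans ?_
        linarith [hinv r]
      have h7 : 2 * r / (r - ‖w‖) ^ 2 ≤ 8 / r := by
        rw [div_le_div_iff₀ (by have : 0 < r - ‖w‖ := by linarith
                                positivity) hr0]
        nlinarith
      refine (h1.trans (mul_le_mul h7 h6 ?_ (by positivity))).trans_eq ?_
      · exact Real.circleAverage_nonneg_of_nonneg fun _ _ ↦ abs_nonneg _
      · rw [hh]; field_simp
    exact norm_le_zero_iff.1 (ge_of_tendsto_of_frequently htend hle)
  have hconst : ∀ z, g z = g 0 := fun z ↦ is_const_of_deriv_eq_zero hgd (fun w ↦ by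
    have := hzero w
    rw [logDeriv_apply, div_eq_zero_iff] at this
    exact this.resolve_right (hg0 w (Set.mem_univ w))) z 0
  obtain ⟨p, q, hq, hpq⟩ :=
    exists_polynomial_prod_zpow_eq s (fun u ↦ MeromorphicOn.divisor f Set.univ u) (g 0)
  refine hf.2 ⟨p, q, hq, ?_⟩
  filter_upwards [heq, compl_finite_mem_codiscreteWithin s.finite_toSet] with z hz hzs
  rw [hz, hconst z]
  exact hpq z (by simpa using hzs)

/-! ### Error terms negligible against `T(r, f)` -/

namespace IsTranscendentalMeromorphic

open ValueDistribution

variable {f : ℂ → ℂ}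

theorem log_isLittleO (hf : IsTranscendentalMeromorphic f) :
    Real.log =o[atTopModFinite] characteristic f ⊤ :=
  hf.log_isLittleO_characteristic.mono atTopModFinite_le_atTop

theorem eventually_nonneg (f : ℂ → ℂ) : ∀ᶠ r in atTopModFinite, 0 ≤ characteristic f ⊤ r :=
  eventually_atTopModFinite_of_atTop
    ((eventually_ge_atTop 1).mono fun _ hr ↦ characteristic_nonneg hr)

theorem tendsto_characteristic (hf : IsTranscendentalMeromorphic f) :
    Tendsto (characteristic f ⊤) atTopModFinite atTop := by
  refine tendsto_atTop_mono' _ ?_ (Real.tendsto_log_atTop.mono_left atTopModFinite_le_atTop)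
  filter_upwards [hf.log_isLittleO.bound one_pos, eventually_nonneg f] with r hr h0
  rw [one_mul, Real.norm_of_nonneg h0] at hr
  exact (Real.le_norm_self _).trans hr

theorem const_isLittleO (hf : IsTranscendentalMeromorphic f) (c : ℝ) :
    (fun _ ↦ c) =o[atTopModFinite] characteristic f ⊤ :=
  isLittleO_const_left.2 (Or.inr (tendsto_norm_atTop_atTop.comp hf.tendsto_characteristic))

theorem log_characteristic_add_isLittleO (hf : IsTranscendentalMeromorphic f) {g : ℂ → ℂ}
    (hg : characteristic g ⊤ =O[atTopModFinite] characteristic f ⊤) :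
    (fun r ↦ Real.log (characteristic g ⊤ r + r)) =o[atTopModFinite] characteristic f ⊤ := by
  obtain ⟨C, hC⟩ := hg.bound
  have h1 : (fun r ↦ Real.log (characteristic f ⊤ r)) =o[atTopModFinite] characteristic f ⊤ :=
    Real.isLittleO_log_id_atTop.comp_tendsto hf.tendsto_characteristic
  have h2 := ((hf.const_isLittleO (Real.log 2 + Real.log (max C 1))).add h1).add hf.log_isLittleO
  refine IsBigO.trans_isLittleO (IsBigO.of_bound 1 ?_) h2
  filter_upwards [hC, eventually_nonneg f, eventually_nonneg g,
    hf.tendsto_characteristic.eventually_ge_atTop 1,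
    eventually_atTopModFinite_of_atTop (eventually_ge_atTop 1)] with r hr hf0 hg0 hf1 hr1
  rw [Real.norm_of_nonneg hf0, Real.norm_of_nonneg hg0] at hr
  have hC1 : 1 ≤ max C 1 := le_max_right _ _
  have h3 : characteristic g ⊤ r ≤ max C 1 * characteristic f ⊤ r :=
    hr.trans (mul_le_mul_of_nonneg_right (le_max_left _ _) hf0)
  have h4 : 1 ≤ max C 1 * characteristic f ⊤ r := by nlinarith
  -- `x + y ≤ 2 x y` for `x, y ≥ 1` turns the logarithm of a sum into a sum of logarithms, each
  -- `o(T(r, f))`.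
  have h5 : characteristic g ⊤ r + r ≤ 2 * max C 1 * characteristic f ⊤ r * r := by
    nlinarith [mul_nonneg (sub_nonneg.2 h4) (sub_nonneg.2 hr1)]
  have h6 := Real.log_le_log (by linarith) h5
  rw [Real.log_mul (by positivity) (by positivity), Real.log_mul (by positivity) (by positivity),
    Real.log_mul (by positivity) (by positivity)] at h6
  rw [Real.norm_of_nonneg (Real.log_nonneg (by linarith)), one_mul]
  exact h6.trans (Real.le_norm_self _)

/-- Logarithmic derivatives of functions growing at most like `f` have small proximity function. -/
theorem proximity_logDeriv_isLittleO (hf : IsTranscendentalMeromorphic f) {g : ℂ → ℂ}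
    (hg : Meromorphic g) (hg0 : ∀ z, meromorphicOrderAt g z ≠ ⊤)
    (hgf : characteristic g ⊤ =O[atTopModFinite] characteristic f ⊤) :
    proximity (logDeriv g) ⊤ =o[atTopModFinite] characteristic f ⊤ :=
  (proximity_logDeriv_isBigO_log hg hg0).trans_isLittleO (hf.log_characteristic_add_isLittleO hgf)

end IsTranscendentalMeromorphic

/-! ### Orders of derivatives and logarithmic derivatives -/

section Divisor

open MeromorphicOn

variable {f g : ℂ → ℂ}

theorem Meromorphic.coe_divisor (hf : Meromorphic f) {z : ℂ} (h : meromorphicOrderAt f z ≠ ⊤) :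
    ((divisor f Set.univ z : ℤ) : WithTop ℤ) = meromorphicOrderAt f z := by
  rw [MeromorphicOn.divisor_apply hf.meromorphicOn (Set.mem_univ z), WithTop.coe_untop₀_of_ne_top h]

theorem Meromorphic.divisor_deriv (hf : Meromorphic f)
    (hf0 : ∀ z, meromorphicOrderAt f z ≠ ⊤) (hf' : ∀ z, meromorphicOrderAt (deriv f) z ≠ ⊤)
    (z : ℂ) :
    divisor (deriv f) Set.univ z =
      divisor (_root_.logDeriv f) Set.univ z + divisor f Set.univ z := by
  have h1 : divisor (_root_.logDeriv f) Set.univ =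
      divisor (deriv f) Set.univ + divisor f⁻¹ Set.univ := by
    rw [← divisor_mul hf.deriv.meromorphicOn hf.inv.meromorphicOn (fun z _ ↦ hf' z)
      fun z _ ↦ by rw [meromorphicOrderAt_inv]; simpa using hf0 z]
    congr 1
  rw [h1, divisor_inv]
  simp

theorem Meromorphic.divisor_logDeriv_of_ne_zero (hf : Meromorphic f)
    (hf0 : ∀ z, meromorphicOrderAt f z ≠ ⊤) {z : ℂ} (hz : divisor f Set.univ z ≠ 0) :
    divisor (_root_.logDeriv f) Set.univ z = -1 := by
  rw [divisor_apply hf.logDeriv.meromorphicOn (Set.mem_univ z),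
    meromorphicOrderAt_logDeriv_eq_neg_one (hf z) ?_ (hf0 z)]
  · rfl
  · rw [← hf.coe_divisor (hf0 z)]
    exact_mod_cast hz

theorem Meromorphic.divisor_logDeriv_nonneg (hf : Meromorphic f)
    (hf0 : ∀ z, meromorphicOrderAt f z ≠ ⊤) {z : ℂ} (hz : divisor f Set.univ z = 0) :
    0 ≤ divisor (_root_.logDeriv f) Set.univ z := by
  rw [divisor_apply hf.logDeriv.meromorphicOn (Set.mem_univ z)]
  refine WithTop.untop₀_nonneg.2 (meromorphicOrderAt_logDeriv_nonneg (hf z) ?_)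
  rw [← hf.coe_divisor (hf0 z), hz]
  rfl

theorem Meromorphic.neg_one_le_divisor_logDeriv (hf : Meromorphic f)
    (hf0 : ∀ z, meromorphicOrderAt f z ≠ ⊤) (z : ℂ) :
    -1 ≤ divisor (_root_.logDeriv f) Set.univ z := by
  by_cases hz : divisor f Set.univ z = 0
  · linarith [hf.divisor_logDeriv_nonneg hf0 hz]
  · exact (hf.divisor_logDeriv_of_ne_zero hf0 hz).ge

theorem Meromorphic.divisor_deriv_nonneg (hf : Meromorphic f)
    (hf0 : ∀ z, meromorphicOrderAt f z ≠ ⊤) (hf' : ∀ z, meromorphicOrderAt (deriv f) z ≠ ⊤)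
    {z : ℂ} (hz : 0 ≤ divisor f Set.univ z) : 0 ≤ divisor (deriv f) Set.univ z := by
  rw [hf.divisor_deriv hf0 hf']
  rcases hz.eq_or_lt with h | h
  · linarith [hf.divisor_logDeriv_nonneg hf0 h.symm]
  · linarith [hf.neg_one_le_divisor_logDeriv hf0 z]

theorem Meromorphic.divisor_sub_const_nonneg (hf : Meromorphic f)
    (hf0 : ∀ z, meromorphicOrderAt f z ≠ ⊤) (c : ℂ) {z : ℂ} (hz : 0 ≤ divisor f Set.univ z) :
    0 ≤ divisor (fun z ↦ f z - c) Set.univ z := by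
  have hc : MeromorphicAt (fun _ ↦ -c : ℂ → ℂ) z := MeromorphicAt.const _ _
  have hsub : Meromorphic fun z ↦ f z - c := hf.sub (Meromorphic.const c)
  rw [divisor_apply hsub.meromorphicOn (Set.mem_univ z)]
  have h : (fun z ↦ f z - c) = f + fun _ ↦ -c := by ext; simp [sub_eq_add_neg]
  refine WithTop.untop₀_nonneg.2 (h ▸ le_trans (le_min ?_ ?_) (meromorphicOrderAt_add (hf z) hc))
  · rw [← hf.coe_divisor (hf0 z)]; exact_mod_cast hz
  · exact analyticAt_const.meromorphicOrderAt_nonneg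

theorem Meromorphic.divisor_sub_const_eq_zero (hf : Meromorphic f)
    (hf0 : ∀ z, meromorphicOrderAt f z ≠ ⊤) {c : ℂ} (hc : c ≠ 0) {z : ℂ}
    (hz : 0 < divisor f Set.univ z) :
    divisor (fun z ↦ f z - c) Set.univ z = 0 := by
  have hcm : MeromorphicAt (fun _ ↦ -c : ℂ → ℂ) z := MeromorphicAt.const _ _
  have hsub : Meromorphic fun z ↦ f z - c := hf.sub (Meromorphic.const c)
  rw [divisor_apply hsub.meromorphicOn (Set.mem_univ z)]
  have h : (fun z ↦ f z - c) = f + fun _ ↦ -c := by ext; simp [sub_eq_add_neg]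
  have h0 : meromorphicOrderAt (fun _ ↦ -c : ℂ → ℂ) z = 0 := by
    classical
    rw [meromorphicOrderAt_const, if_neg (neg_ne_zero.2 hc)]
  rw [h, meromorphicOrderAt_add_eq_right_of_lt (hf z), h0]
  · rfl
  · rw [h0, ← hf.coe_divisor (hf0 z)]; exact_mod_cast hz

end Divisor

/-! ### Characteristics of derivatives and products -/

namespace ValueDistribution

open MeromorphicOn

/-- A pole of order `p ≥ 1` becomes one of order `p + 1 ≤ 2 p`. -/
theorem logCounting_deriv_le {g : ℂ → ℂ} (hg : Meromorphic g)
    (hg0 : ∀ z, meromorphicOrderAt g z ≠ ⊤) (hg' : ∀ z, meromorphicOrderAt (deriv g) z ≠ ⊤)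
    {r : ℝ} (hr : 1 ≤ r) : logCounting (deriv g) ⊤ r ≤ 2 * logCounting g ⊤ r := by
  have h : (divisor (deriv g) Set.univ)⁻ ≤ 2 • (divisor g Set.univ)⁻ := by
    intro z
    change (divisor (deriv g) Set.univ z)⁻ ≤ 2 • (divisor g Set.univ z)⁻
    rw [hg.divisor_deriv hg0 hg']
    rcases eq_or_ne (divisor g Set.univ z) 0 with h0 | h0
    · rw [h0, add_zero, negPart_zero, smul_zero,
        negPart_eq_zero.2 (hg.divisor_logDeriv_nonneg hg0 h0)]
    · rw [hg.divisor_logDeriv_of_ne_zero hg0 h0, negPart_def, negPart_def, nsmul_eq_mul]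
      simp only [Int.max_def, Nat.cast_ofNat]
      split_ifs <;> omega
  have := Function.locallyFinsuppWithin.logCounting_le h hr
  rw [map_nsmul] at this
  simpa [logCounting_top] using this

theorem characteristic_deriv_le {g : ℂ → ℂ} (hg : Meromorphic g)
    (hg0 : ∀ z, meromorphicOrderAt g z ≠ ⊤) (hg' : ∀ z, meromorphicOrderAt (deriv g) z ≠ ⊤)
    {r : ℝ} (hr : 1 ≤ r) :
    characteristic (deriv g) ⊤ r ≤ proximity (logDeriv g) ⊤ r + 2 * characteristic g ⊤ r := by
  have h1 : deriv g =ᶠ[codiscrete ℂ] logDeriv g * g := by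
    filter_upwards [hg.eventually_codiscrete_ne_zero hg0] with z hz
    rw [Pi.mul_apply, logDeriv_apply, div_mul_cancel₀ _ hz]
  have h2 : proximity (deriv g) ⊤ r ≤ proximity (logDeriv g) ⊤ r + proximity g ⊤ r := by
    rw [proximity_congr_codiscrete h1 (by linarith)]
    exact proximity_mul_top_le hg.logDeriv hg r
  have h3 := logCounting_deriv_le hg hg0 hg' hr
  have h4 : 0 ≤ proximity g ⊤ r := proximity_nonneg r
  simp only [characteristic, Pi.add_apply]
  linarith

theorem proximity_isBigO_characteristic (g : ℂ → ℂ) :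
    proximity g ⊤ =O[atTopModFinite] characteristic g ⊤ := by
  refine IsBigO.of_bound 1 ?_
  filter_upwards [eventually_atTopModFinite_of_atTop (eventually_ge_atTop 1)] with r hr
  have h0 : 0 ≤ proximity g ⊤ r := proximity_nonneg r
  rw [one_mul, Real.norm_of_nonneg h0, Real.norm_of_nonneg (characteristic_nonneg hr)]
  exact proximity_top_le_characteristic g hr

theorem isLittleO_of_eventually_le {u v T : ℝ → ℝ} {l : Filter ℝ} (hv : v =o[l] T)
    (h0 : ∀ᶠ r in l, 0 ≤ u r) (h : ∀ᶠ r in l, u r ≤ v r) : u =o[l] T := by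
  refine IsBigO.trans_isLittleO (IsBigO.of_bound 1 ?_) hv
  filter_upwards [h0, h] with r hr0 hr
  rw [one_mul, Real.norm_of_nonneg hr0]
  exact hr.trans (Real.le_norm_self _)

theorem isBigO_of_eventually_le {u v T : ℝ → ℝ} {l : Filter ℝ} (hv : v =O[l] T)
    (h0 : ∀ᶠ r in l, 0 ≤ u r) (h : ∀ᶠ r in l, u r ≤ v r) : u =O[l] T := by
  refine IsBigO.trans (IsBigO.of_bound 1 ?_) hv
  filter_upwards [h0, h] with r hr0 hr
  rw [one_mul, Real.norm_of_nonneg hr0]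
  exact hr.trans (Real.le_norm_self _)

theorem proximity_prod_isLittleO {ι : Type*} {T : ℝ → ℝ} {s : Finset ι} {h : ι → ℂ → ℂ}
    (hT : (fun _ ↦ (0 : ℝ)) =o[atTopModFinite] T)
    (hm : ∀ i, Meromorphic (h i))
    (ho : ∀ i ∈ s, proximity (h i) ⊤ =o[atTopModFinite] T) :
    proximity (∏ i ∈ s, h i) ⊤ =o[atTopModFinite] T := by
  classical
  induction s using Finset.induction_on with
  | empty =>
    have : proximity (∏ i ∈ ∅, h i) ⊤ = fun _ ↦ (0 : ℝ) := by
      ext r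
      rw [Finset.prod_empty]
      exact (proximity_const (c := (1 : ℂ))).trans (by simp)
    rwa [this]
  | insert i s hi ih =>
    rw [Finset.prod_insert hi]
    refine isLittleO_of_eventually_le ((ho i (Finset.mem_insert_self i s)).add
      (ih fun j hj ↦ ho j (Finset.mem_insert_of_mem hj)))
      (Eventually.of_forall fun r ↦ proximity_nonneg r) (Eventually.of_forall fun r ↦ ?_)
    exact proximity_mul_top_le (hm i) (Meromorphic.prod fun j _ ↦ hm j) r

theorem meromorphicOrderAt_prod_ne_top {ι : Type*} {s : Finset ι} {h : ι → ℂ → ℂ}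
    (hm : ∀ i, Meromorphic (h i)) (ho : ∀ i z, meromorphicOrderAt (h i) z ≠ ⊤) (z : ℂ) :
    meromorphicOrderAt (∏ i ∈ s, h i) z ≠ ⊤ := by
  rw [meromorphicOrderAt_prod fun i _ ↦ hm i z]
  exact WithTop.sum_ne_top.2 fun i _ ↦ ho i z

theorem characteristic_prod_isBigO {ι : Type*} {T : ℝ → ℝ} {s : Finset ι} {h : ι → ℂ → ℂ}
    (hm : ∀ i, Meromorphic (h i)) (h0 : ∀ i z, meromorphicOrderAt (h i) z ≠ ⊤)
    (ho : ∀ i ∈ s, characteristic (h i) ⊤ =O[atTopModFinite] T) :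
    characteristic (∏ i ∈ s, h i) ⊤ =O[atTopModFinite] T := by
  classical
  induction s using Finset.induction_on with
  | empty =>
    have : characteristic (∏ i ∈ ∅, h i) ⊤ = fun _ ↦ (0 : ℝ) := by
      ext r
      rw [Finset.prod_empty]
      change proximity (fun _ ↦ (1 : ℂ)) ⊤ r + logCounting (fun _ ↦ (1 : ℂ)) ⊤ r = 0
      rw [proximity_const, logCounting_const]
      simp
    rw [this]
    exact isBigO_zero _ _
  | insert i s hi ih =>
    rw [Finset.prod_insert hi]
    refine isBigO_of_eventually_le ((ho i (Finset.mem_insert_self i s)).add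
      (ih fun j hj ↦ ho j (Finset.mem_insert_of_mem hj)))
      (eventually_atTopModFinite_of_atTop (characteristic_eventually_nonneg)) ?_
    exact eventually_atTopModFinite_of_atTop (characteristic_mul_top_eventuallyLE (hm i) (h0 i)
      (Meromorphic.prod fun j _ ↦ hm j) (meromorphicOrderAt_prod_ne_top hm h0))

end ValueDistribution

namespace IsTranscendentalMeromorphic

open ValueDistribution

variable {f : ℂ → ℂ}

theorem characteristic_iteratedDeriv_isBigO (hf : IsTranscendentalMeromorphic f) (n : ℕ) :
    characteristic (iteratedDeriv n f) ⊤ =O[atTopModFinite] characteristic f ⊤ := by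
  induction n with
  | zero => rw [iteratedDeriv_zero]
  | succ n ih =>
    have hm := hf.1.iteratedDeriv n
    have h0 := hf.meromorphicOrderAt_iteratedDeriv_ne_top n
    have h' := hf.meromorphicOrderAt_iteratedDeriv_ne_top (n + 1)
    rw [iteratedDeriv_succ] at h' ⊢
    refine isBigO_of_eventually_le ((hf.proximity_logDeriv_isLittleO hm h0 ih).isBigO.add
      (ih.const_mul_left 2)) (eventually_nonneg _) ?_
    filter_upwards [eventually_atTopModFinite_of_atTop (eventually_ge_atTop 1)] with r hr
    exact characteristic_deriv_le hm h0 h' hr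

/-- The quotient telescopes into logarithmic derivatives of successive derivatives, each of which
grows at most like `f`. -/
theorem proximity_iteratedDeriv_div_isLittleO (hf : IsTranscendentalMeromorphic f) (n : ℕ) :
    proximity (iteratedDeriv n f / f) ⊤ =o[atTopModFinite] characteristic f ⊤ := by
  induction n with
  | zero =>
    refine isLittleO_of_eventually_le (hf.const_isLittleO 0)
      (Eventually.of_forall fun r ↦ proximity_nonneg r) ?_
    filter_upwards [eventually_atTopModFinite_of_atTop (eventually_ge_atTop 1)] with r hr
    have h : iteratedDeriv 0 f / f =ᶠ[codiscrete ℂ] fun _ ↦ (1 : ℂ) := by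
      filter_upwards [hf.1.eventually_codiscrete_ne_zero hf.meromorphicOrderAt_ne_top] with z hz
      rw [iteratedDeriv_zero, Pi.div_apply, div_self hz]
    rw [proximity_congr_codiscrete h (by linarith), proximity_const]
    simp
  | succ n ih =>
    have hm := hf.1.iteratedDeriv n
    have h0 := hf.meromorphicOrderAt_iteratedDeriv_ne_top n
    refine isLittleO_of_eventually_le ((hf.proximity_logDeriv_isLittleO hm h0
      (hf.characteristic_iteratedDeriv_isBigO n)).add ih)
      (Eventually.of_forall fun r ↦ proximity_nonneg r) ?_
    filter_upwards [eventually_atTopModFinite_of_atTop (eventually_ge_atTop 1)] with r hr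
    have h : iteratedDeriv (n + 1) f / f =ᶠ[codiscrete ℂ]
        logDeriv (iteratedDeriv n f) * (iteratedDeriv n f / f) := by
      filter_upwards [hm.eventually_codiscrete_ne_zero h0] with z hz
      rw [iteratedDeriv_succ, Pi.div_apply, Pi.mul_apply, Pi.div_apply, logDeriv_apply,
        div_mul_div_cancel₀ hz]
    rw [proximity_congr_codiscrete h (by linarith)]
    exact proximity_mul_top_le hm.logDeriv (hm.div hf.1) r

end IsTranscendentalMeromorphic

/-! ### The main inequality for differential monomials -/

open ValueDistribution in
open MeromorphicOn in
/-- Milloux's estimate for `m(r, 1/F)`. -/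
theorem exists_proximity_inv_le {F : ℂ → ℂ} (hF : Meromorphic F)
    (hF0 : ∀ z, meromorphicOrderAt F z ≠ ⊤) (hF1 : ∀ z, meromorphicOrderAt (fun z ↦ F z - 1) z ≠ ⊤)
    (hF' : ∀ z, meromorphicOrderAt (deriv F) z ≠ ⊤) :
    ∃ c : ℝ, ∀ r : ℝ, r ≠ 0 → proximity F⁻¹ ⊤ r ≤ proximity (logDeriv F) ⊤ r +
      proximity (logDeriv fun z ↦ F z - 1) ⊤ r -
      (divisor (logDeriv fun z ↦ F z - 1) Set.univ).logCounting r + c := by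
  have hsub : Meromorphic fun z ↦ F z - 1 := hF.sub (Meromorphic.const 1)
  have hd : deriv (fun z ↦ F z - 1) = deriv F := by ext z; exact deriv_sub_const 1
  set G := logDeriv fun z ↦ F z - 1 with hG
  have hGm : Meromorphic G := hsub.logDeriv
  refine ⟨Real.log 2 - Real.log ‖meromorphicTrailingCoeffAt G 0‖, fun r hr ↦ ?_⟩
  -- Since `G⁻¹ (F'/F) = (F - 1) / F = 1 - 1/F`.
  have h1 : F⁻¹ =ᶠ[codiscrete ℂ] (fun _ ↦ (1 : ℂ)) + (-G⁻¹) * logDeriv F := by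
    filter_upwards [hF.eventually_codiscrete_ne_zero hF0, hsub.eventually_codiscrete_ne_zero hF1,
      hF.deriv.eventually_codiscrete_ne_zero hF'] with z hz hz1 hz'
    simp only [hG, Pi.add_apply, Pi.mul_apply, Pi.neg_apply, Pi.inv_apply, logDeriv_apply, hd]
    field_simp
    ring
  have h2 : proximity (-G⁻¹) ⊤ = proximity G⁻¹ ⊤ := by
    simp [proximity_top]
  have h3 : proximity F⁻¹ ⊤ r ≤ proximity G⁻¹ ⊤ r + proximity (logDeriv F) ⊤ r + Real.log 2 := by
    rw [proximity_congr_codiscrete h1 hr, ← h2]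
    have h4 := proximity_add_top_le (Meromorphic.const (1 : ℂ)) (hGm.inv.neg.mul hF.logDeriv) r
    have h5 := proximity_mul_top_le hGm.inv.neg hF.logDeriv r
    simp only [Pi.add_apply, proximity_const, norm_one, Real.posLog_one, zero_add] at h4 h5
    linarith
  -- Jensen's formula replaces `m(r, 1/G)` by `m(r, G) - N(r, div G)` plus a constant. The signed
  -- divisor is kept because its zeros are needed later.
  have h6 := congrFun (proximity_sub_proximity_inv_eq_circleAverage hGm) r
  have h7 := Function.locallyFinsuppWithin.logCounting_divisor_eq_circleAverage_sub_const hGm hr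
  rw [Pi.sub_apply] at h6
  linarith

/-- The product of powers of derivatives of `f` in a differential monomial. -/
noncomputable def derivProd (k : ℕ) (q : ℕ → ℕ) (f : ℂ → ℂ) : ℂ → ℂ :=
  ∏ i ∈ Finset.range (k + 1), iteratedDeriv i f ^ q i

namespace IsTranscendentalMeromorphic

open ValueDistribution MeromorphicOn

variable {f b F : ℂ → ℂ} {k : ℕ} {q : ℕ → ℕ}

theorem meromorphicOrderAt_iteratedDeriv_pow_ne_top (hf : IsTranscendentalMeromorphic f) (i : ℕ)
    (z : ℂ) : meromorphicOrderAt (iteratedDeriv i f ^ q i) z ≠ ⊤ := by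
  rw [meromorphicOrderAt_pow (hf.1.iteratedDeriv i z)]
  have := hf.meromorphicOrderAt_iteratedDeriv_ne_top i z
  lift meromorphicOrderAt (iteratedDeriv i f) z to ℤ using this with n
  exact WithTop.coe_ne_top (a := (q i : ℤ) * n)

theorem meromorphic_derivProd (hf : IsTranscendentalMeromorphic f) :
    Meromorphic (derivProd k q f) :=
  Meromorphic.prod fun i _ ↦ (hf.1.iteratedDeriv i).pow

theorem meromorphicOrderAt_derivProd_ne_top (hf : IsTranscendentalMeromorphic f) (z : ℂ) :
    meromorphicOrderAt (derivProd k q f) z ≠ ⊤ :=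
  meromorphicOrderAt_prod_ne_top (fun i ↦ (hf.1.iteratedDeriv i).pow)
    (fun i z ↦ hf.meromorphicOrderAt_iteratedDeriv_pow_ne_top i z) z

theorem characteristic_derivProd_isBigO (hf : IsTranscendentalMeromorphic f) :
    characteristic (derivProd k q f) ⊤ =O[atTopModFinite] characteristic f ⊤ := by
  refine characteristic_prod_isBigO (fun i ↦ (hf.1.iteratedDeriv i).pow)
    (fun i z ↦ hf.meromorphicOrderAt_iteratedDeriv_pow_ne_top i z) fun i _ ↦ ?_
  rw [characteristic_pow_top (hf.1.iteratedDeriv i), nsmul_eq_mul]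
  exact (hf.characteristic_iteratedDeriv_isBigO i).const_mul_left (q i : ℝ)

theorem divisor_iteratedDeriv_nonneg (hf : IsTranscendentalMeromorphic f) (i : ℕ) {z : ℂ}
    (hz : 0 ≤ divisor f Set.univ z) : 0 ≤ divisor (iteratedDeriv i f) Set.univ z := by
  induction i with
  | zero => rwa [iteratedDeriv_zero]
  | succ i ih =>
    have h' := hf.meromorphicOrderAt_iteratedDeriv_ne_top (i + 1)
    rw [iteratedDeriv_succ] at h' ⊢
    exact (hf.1.iteratedDeriv i).divisor_deriv_nonneg (hf.meromorphicOrderAt_iteratedDeriv_ne_top i)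
      h' ih

/-- Where `f` has no pole, neither do its derivatives, so every factor but `f ^ q 0` can be dropped.
-/
theorem mul_divisor_le_divisor_derivProd (hf : IsTranscendentalMeromorphic f) {z : ℂ}
    (hz : 0 ≤ divisor f Set.univ z) :
    q 0 * divisor f Set.univ z ≤ divisor (derivProd k q f) Set.univ z := by
  have h1 : divisor (derivProd k q f) Set.univ z =
      ∑ i ∈ Finset.range (k + 1), (q i : ℤ) * divisor (iteratedDeriv i f) Set.univ z := by
    rw [derivProd, divisor_prod (fun i _ ↦ ((hf.1.iteratedDeriv i).pow).meromorphicOn)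
      fun i _ z _ ↦ hf.meromorphicOrderAt_iteratedDeriv_pow_ne_top i z,
      Function.locallyFinsuppWithin.coe_sum, Finset.sum_apply]
    refine Finset.sum_congr rfl fun i _ ↦ ?_
    rw [divisor_pow (hf.1.iteratedDeriv i).meromorphicOn]
    simp
  rw [h1]
  have h2 := Finset.single_le_sum (f := fun i ↦ (q i : ℤ) * divisor (iteratedDeriv i f) Set.univ z)
    (fun i _ ↦ mul_nonneg (Int.natCast_nonneg _) (hf.divisor_iteratedDeriv_nonneg i hz))
    (Finset.mem_range.2 (Nat.succ_pos k))
  simpa using h2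

theorem divisor_mul_derivProd (hf : IsTranscendentalMeromorphic f) (hb : Meromorphic b)
    (hb0 : ∀ z, meromorphicOrderAt b z ≠ ⊤) (z : ℂ) :
    divisor (b * derivProd k q f) Set.univ z =
      divisor b Set.univ z + divisor (derivProd k q f) Set.univ z := by
  rw [divisor_mul hb.meromorphicOn hf.meromorphic_derivProd.meromorphicOn (fun z _ ↦ hb0 z)
    fun z _ ↦ hf.meromorphicOrderAt_derivProd_ne_top z]
  rfl

/-- The proximity function of `1/f` is controlled by the one of the reciprocal of a differential
monomial. -/
theorem exists_mul_proximity_inv_le (hf : IsTranscendentalMeromorphic f) (hb : Meromorphic b)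
    (hb0 : ∀ z, meromorphicOrderAt b z ≠ ⊤)
    (hbf : characteristic b ⊤ =o[atTopModFinite] characteristic f ⊤) (hq : 1 ≤ q 0) :
    ∃ ε : ℝ → ℝ, ε =o[atTopModFinite] characteristic f ⊤ ∧
      ∀ r ≠ 0, proximity f⁻¹ ⊤ r ≤ proximity (b * derivProd k q f)⁻¹ ⊤ r + ε r := by
  set Q : ℂ → ℂ := ∏ i ∈ Finset.range (k + 1), (iteratedDeriv i f / f) ^ q i with hQ
  set n := ∑ i ∈ Finset.range (k + 1), q i with hn
  have hn1 : 1 ≤ n := hq.trans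
    (Finset.single_le_sum (fun _ _ ↦ Nat.zero_le _) (Finset.mem_range.2 (Nat.succ_pos k)))
  have hQm : Meromorphic Q := Meromorphic.prod fun i _ ↦ ((hf.1.iteratedDeriv i).div hf.1).pow
  have hQo : proximity Q ⊤ =o[atTopModFinite] characteristic f ⊤ := by
    refine proximity_prod_isLittleO (hf.const_isLittleO 0)
      (fun i ↦ ((hf.1.iteratedDeriv i).div hf.1).pow) fun i _ ↦ ?_
    rw [proximity_pow_top, nsmul_eq_mul]
    exact (hf.proximity_iteratedDeriv_div_isLittleO i).const_mul_left (q i : ℝ)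
  refine ⟨fun r ↦ proximity b ⊤ r + proximity Q ⊤ r,
    ((proximity_isBigO_characteristic b).trans_isLittleO hbf).add hQo, fun r hr ↦ ?_⟩
  -- Homogeneity: the monomial has total degree `n`, so dividing each factor by `f` leaves `Q`, a
  -- product of quotients `f⁽ⁱ⁾ / f`. At the end `n ≥ 1` allows `n m(r, 1/f)` to be replaced by
  -- `m(r, 1/f)`.
  have h1 : f⁻¹ ^ n =ᶠ[codiscrete ℂ] (b * derivProd k q f)⁻¹ * (b * Q) := by
    have hall : ∀ᶠ z in codiscrete ℂ, ∀ i ∈ Finset.range (k + 1), iteratedDeriv i f z ≠ 0 :=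
      (eventually_all_finset _).2 fun i _ ↦ (hf.1.iteratedDeriv i).eventually_codiscrete_ne_zero
        (hf.meromorphicOrderAt_iteratedDeriv_ne_top i)
    filter_upwards [hall, hb.eventually_codiscrete_ne_zero hb0,
      hf.1.eventually_codiscrete_ne_zero hf.meromorphicOrderAt_ne_top] with z hz hbz hfz
    have hP : derivProd k q f z ≠ 0 := by
      rw [derivProd, Finset.prod_apply]
      exact Finset.prod_ne_zero_iff.2 fun i hi ↦ pow_ne_zero _ (hz i hi)
    have hQz : Q z = derivProd k q f z * (f z)⁻¹ ^ n := by
      rw [hQ, derivProd, Finset.prod_apply, Finset.prod_apply, hn, ← Finset.prod_pow_eq_pow_sum,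
        ← Finset.prod_mul_distrib]
      refine Finset.prod_congr rfl fun i _ ↦ ?_
      rw [Pi.pow_apply, Pi.pow_apply, Pi.div_apply, div_eq_mul_inv, mul_pow]
    simp only [Pi.mul_apply, Pi.inv_apply, Pi.pow_apply, hQz]
    field_simp
  have hF : Meromorphic (b * derivProd k q f) := hb.mul hf.meromorphic_derivProd
  have h2 := proximity_mul_top_le hF.inv (hb.mul hQm) r
  have h3 := proximity_mul_top_le hb hQm r
  rw [← proximity_congr_codiscrete h1 hr, proximity_pow_top] at h2
  simp only [Pi.add_apply, Pi.smul_apply, nsmul_eq_mul] at h2 h3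
  have h4 : 0 ≤ proximity f⁻¹ ⊤ r := proximity_nonneg r
  have h5 : (1 : ℝ) ≤ n := by exact_mod_cast hn1
  nlinarith

theorem logCounting_abs_divisor_isLittleO (hf : IsTranscendentalMeromorphic f)
    (hb : Meromorphic b) (hbf : characteristic b ⊤ =o[atTopModFinite] characteristic f ⊤) :
    Function.locallyFinsuppWithin.logCounting |divisor b Set.univ| =o[atTopModFinite]
      characteristic f ⊤ := by
  obtain ⟨B, -, hB⟩ := exists_characteristic_inv_le hb
  refine isLittleO_of_eventually_le ((hbf.const_mul_left 2).add (hf.const_isLittleO B)) ?_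
    (Eventually.of_forall fun r ↦ ?_)
  · exact eventually_atTopModFinite_of_atTop ((eventually_ge_atTop 1).mono fun r hr ↦
      Function.locallyFinsuppWithin.logCounting_nonneg (abs_nonneg _) hr)
  · have h1 := logCounting_top_le_characteristic b r
    have h2 := logCounting_top_le_characteristic b⁻¹ r
    rw [logCounting_inv] at h2
    rw [logCounting_abs_divisor, Pi.add_apply]
    linarith [hB r]

/-- The local comparison of the zeros and poles of `f` with those of `F = b f^{q₀} ⋯` and of the
logarithmic derivative of `F - 1`. -/
theorem divisor_le (hf : IsTranscendentalMeromorphic f)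
    (hpoles : ∀ z : ℂ, meromorphicOrderAt f z ≠ -1) (hb : Meromorphic b)
    (hb0 : ∀ z, meromorphicOrderAt b z ≠ ⊤) (hq0 : 2 ≤ q 0)
    (hF : F = b * derivProd k q f) (hF0 : ∀ z, meromorphicOrderAt F z ≠ ⊤)
    (hF1 : ∀ z, meromorphicOrderAt (fun z ↦ F z - 1) z ≠ ⊤)
    (hF' : ∀ z, meromorphicOrderAt (deriv F) z ≠ ⊤) :
    2 • (divisor f Set.univ)⁺ ≤ (divisor f Set.univ)⁻ +
      2 • divisor (logDeriv fun z ↦ F z - 1) Set.univ +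
      2 • (divisor (fun z ↦ F z - 1) Set.univ)⁺ + 4 • |divisor b Set.univ| := by
  have hFm : Meromorphic F := hF ▸ hb.mul hf.meromorphic_derivProd
  have hsub : Meromorphic fun z ↦ F z - 1 := hFm.sub (Meromorphic.const 1)
  have hd : deriv (fun z ↦ F z - 1) = deriv F := by ext z; exact deriv_sub_const 1
  intro z
  change 2 • (divisor f Set.univ z)⁺ ≤ (divisor f Set.univ z)⁻ +
      2 • divisor (logDeriv fun z ↦ F z - 1) Set.univ z +
      2 • (divisor (fun z ↦ F z - 1) Set.univ z)⁺ + 4 • |divisor b Set.univ z|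
  have hdF := hf.divisor_mul_derivProd (k := k) (q := q) hb hb0 z
  rw [← hF] at hdF
  have hG := hsub.neg_one_le_divisor_logDeriv hF1 z
  have hne : divisor f Set.univ z ≠ -1 := fun h ↦ hpoles z (by
    rw [← hf.1.coe_divisor (hf.meromorphicOrderAt_ne_top z), h]; rfl)
  have hpos := fun h ↦ hf.mul_divisor_le_divisor_derivProd (k := k) (q := q) (z := z) h
  have hF'div := hFm.divisor_deriv hF0 hF' z
  have hsub'div := hsub.divisor_deriv hF1 (by rwa [hd]) z
  rw [hd] at hsub'div
  have hsub0 := hFm.divisor_sub_const_nonneg hF0 1 (z := z)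
  have hsub1 := hFm.divisor_sub_const_eq_zero hF0 one_ne_zero (z := z)
  have hlogF := hFm.divisor_logDeriv_of_ne_zero hF0 (z := z)
  have hlogF1 := hsub.divisor_logDeriv_nonneg hF1 (z := z)
  simp only [posPart_def, negPart_def, nsmul_eq_mul, Nat.cast_ofNat] at *
  have hq0' : (2 : ℤ) ≤ q 0 := by exact_mod_cast hq0
  have hpos' : 0 ≤ divisor f Set.univ z →
      2 * divisor f Set.univ z ≤ divisor (derivProd k q f) Set.univ z := fun h ↦
    (mul_le_mul_of_nonneg_right hq0' h).trans (hpos h)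
  clear hpos
  -- Cases on the order `d` of `f`. If `d ≤ -2`, then `-d` pays for a simple pole of `G`. If `d > 0`
  -- and `F` vanishes, `G` has order `div F - 1 ≥ 2 d + div b - 1`; if `F` does not vanish, `|div b|
  -- ≥ 2 d` suffices. If `d = 0`, a pole of `G` comes from a zero of `F - 1` or from a pole of `F`,
  -- hence of `b`.
  grind

/-- If `T(r, 1/f)` is dominated by half of `T(r, f)`, up to a small error, we have a
contradiction. -/
theorem false_of_two_mul_characteristic_inv_le (hf : IsTranscendentalMeromorphic f) {ε : ℝ → ℝ}
    (hε : ε =o[atTopModFinite] characteristic f ⊤)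
    (h : ∀ᶠ r in atTopModFinite,
      2 * characteristic f⁻¹ ⊤ r ≤ characteristic f ⊤ r + ε r) : False := by
  obtain ⟨B, -, hB⟩ := exists_characteristic_inv_le hf.1.inv
  rw [inv_inv] at hB
  have hε' := (hε.add (hf.const_isLittleO (2 * B))).bound (half_pos one_pos)
  obtain ⟨r, hr, hr', hr1⟩ :=
    (h.and (hε'.and (hf.tendsto_characteristic.eventually_ge_atTop 1))).exists
  rw [Real.norm_of_nonneg (by linarith : 0 ≤ characteristic f ⊤ r)] at hr'
  have := (Real.le_norm_self _).trans hr'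
  linarith [hB r]

/-- A differential monomial in `f` with small coefficient and a high power of `f` is not
constant. -/
theorem false_of_mul_derivProd_eventuallyEq_const (hf : IsTranscendentalMeromorphic f)
    (hb : Meromorphic b) (hb0 : ∀ z, meromorphicOrderAt b z ≠ ⊤)
    (hbf : characteristic b ⊤ =o[atTopModFinite] characteristic f ⊤) (hq0 : 1 ≤ q 0) {c : ℂ}
    (hc : b * derivProd k q f =ᶠ[codiscrete ℂ] fun _ ↦ c) : False := by
  -- A constant monomial forces zeros of `f` to be poles of `b`, so `N(r, 1/f)` is small; `m(r,
  -- 1/f)` is small too, as `m(r, 1/F)` is constant.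
  have hdiv : (divisor f Set.univ)⁺ ≤ |divisor b Set.univ| := by
    intro z
    change (divisor f Set.univ z)⁺ ≤ |divisor b Set.univ z|
    have h1 := hf.divisor_mul_derivProd (k := k) (q := q) hb hb0 z
    rw [divisor_congr_codiscreteWithin hc isOpen_univ, divisor_const] at h1
    simp only [Function.locallyFinsuppWithin.coe_zero, Pi.zero_apply] at h1
    rcases le_or_gt 0 (divisor f Set.univ z) with h | h
    · have h2 := hf.mul_divisor_le_divisor_derivProd (k := k) (q := q) h
      have h3 : (1 : ℤ) ≤ q 0 := by exact_mod_cast hq0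
      rw [posPart_of_nonneg h]
      have h4 := neg_le_abs (divisor b Set.univ z)
      nlinarith
    · rw [posPart_of_nonpos h.le]
      exact abs_nonneg _
  obtain ⟨ε, hε, hle⟩ := hf.exists_mul_proximity_inv_le (k := k) hb hb0 hbf hq0
  refine hf.false_of_two_mul_characteristic_inv_le
    (((hf.const_isLittleO (Real.posLog ‖c⁻¹‖)).add (hε.add
      (hf.logCounting_abs_divisor_isLittleO hb hbf))).const_mul_left 2) ?_
  filter_upwards [eventually_atTopModFinite_of_atTop (eventually_ge_atTop 1),
    eventually_nonneg f] with r hr hr0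
  have h1 := Function.locallyFinsuppWithin.logCounting_le hdiv hr
  rw [← logCounting_zero] at h1
  have h2 := hle r (by linarith)
  have hc' : (b * derivProd k q f)⁻¹ =ᶠ[codiscrete ℂ] fun _ ↦ c⁻¹ := hc.fun_comp (·⁻¹)
  rw [proximity_congr_codiscrete hc' (by linarith), proximity_const] at h2
  simp only [characteristic, Pi.add_apply, logCounting_inv] at hr0 ⊢
  linarith

/-- If `b` is small and `f` has no simple poles, then `b f^{q₀} (f')^{q₁} ⋯` takes the value `1`
often. -/
theorem not_logCounting_sub_one_isLittleO (hf : IsTranscendentalMeromorphic f)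
    (hpoles : ∀ z : ℂ, meromorphicOrderAt f z ≠ -1) (hb : Meromorphic b)
    (hb0 : ∀ z, meromorphicOrderAt b z ≠ ⊤)
    (hbf : characteristic b ⊤ =o[atTopModFinite] characteristic f ⊤) (hq0 : 2 ≤ q 0)
    (hF : F = b * derivProd k q f) :
    ¬ logCounting (fun z ↦ F z - 1) 0 =o[atTopModFinite] characteristic f ⊤ := by
  intro hN
  have hPm : Meromorphic (derivProd k q f) := hf.meromorphic_derivProd
  have hP0 := hf.meromorphicOrderAt_derivProd_ne_top (k := k) (q := q)
  have hFm : Meromorphic F := hF ▸ hb.mul hPm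
  have hsub : Meromorphic fun z ↦ F z - 1 := hFm.sub (Meromorphic.const 1)
  have hd : deriv (fun z ↦ F z - 1) = deriv F := by ext z; exact deriv_sub_const 1
  -- Nonconstancy yields at once that none of `F`, `F - 1`, `F'` vanishes identically.
  have hconst : ∀ c : ℂ, ¬ F =ᶠ[codiscrete ℂ] fun _ ↦ c := fun c hc ↦
    hf.false_of_mul_derivProd_eventuallyEq_const hb hb0 hbf (by omega) (hF ▸ hc)
  have hF0 : ∀ z, meromorphicOrderAt F z ≠ ⊤ :=
    hFm.meromorphicOrderAt_ne_top_of_not_eventuallyEq_zero (hconst 0)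
  have hF' : ∀ z, meromorphicOrderAt (deriv F) z ≠ ⊤ := fun z h ↦ by
    obtain ⟨c, hc⟩ := hFm.eventuallyEq_const_of_deriv h
    exact hconst c hc
  have hF1 : ∀ z, meromorphicOrderAt (fun z ↦ F z - 1) z ≠ ⊤ :=
    hsub.meromorphicOrderAt_ne_top_of_not_eventuallyEq_zero fun h ↦
      hconst 1 (h.mono fun z hz ↦ sub_eq_zero.1 hz)
  have hTF : characteristic F ⊤ =O[atTopModFinite] characteristic f ⊤ := by
    refine isBigO_of_eventually_le (hbf.isBigO.add
      (hf.characteristic_derivProd_isBigO (k := k) (q := q))) (eventually_nonneg F) ?_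
    rw [hF]
    exact eventually_atTopModFinite_of_atTop (characteristic_mul_top_eventuallyLE hb hb0 hPm hP0)
  have hTF1 : characteristic (fun z ↦ F z - 1) ⊤ =O[atTopModFinite] characteristic f ⊤ := by
    refine isBigO_of_eventually_le
      (hTF.add (hf.const_isLittleO (Real.posLog ‖(1 : ℂ)‖ + Real.log 2)).isBigO)
      (eventually_nonneg _) (Eventually.of_forall fun r ↦ ?_)
    have := (abs_le.1 (abs_characteristic_sub_characteristic_shift_le (a₀ := 1) (r := r) hFm)).1
    linarith
  obtain ⟨c, hMilloux⟩ := exists_proximity_inv_le hFm hF0 hF1 hF'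
  obtain ⟨ε, hε, hle⟩ := hf.exists_mul_proximity_inv_le (k := k) hb hb0 hbf (q := q) (by omega)
  have hdiv := hf.divisor_le hpoles hb hb0 hq0 hF hF0 hF1 hF'
  refine hf.false_of_two_mul_characteristic_inv_le
    ((((((hf.proximity_logDeriv_isLittleO hFm hF0 hTF).add
      (hf.proximity_logDeriv_isLittleO hsub hF1 hTF1)).add (hf.const_isLittleO c)).add
      hε).add (hN.add ((hf.logCounting_abs_divisor_isLittleO hb hbf).const_mul_left
        2))).const_mul_left 2) ?_
  filter_upwards [eventually_atTopModFinite_of_atTop (eventually_ge_atTop 1)] with r hr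
  -- Here `2 N(r, div G)` enters with a plus sign; doubling Milloux's estimate supplies it with a
  -- minus sign.
  have h1 := Function.locallyFinsuppWithin.logCounting_le hdiv hr
  simp only [map_add, map_nsmul, Pi.add_apply, Pi.smul_apply, ← logCounting_zero,
    ← logCounting_top, nsmul_eq_mul, Nat.cast_ofNat, Pi.mul_apply, Pi.ofNat_apply] at h1
  have h2 := hle r (by linarith)
  have h3 := hMilloux r (by linarith)
  have h4 := logCounting_top_le_characteristic f r
  rw [← hF] at h2
  simp only [characteristic, Pi.add_apply, logCounting_inv] at h4 ⊢
  linarith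

end IsTranscendentalMeromorphic

/-! ### Reduction of the theorem to the value `1` -/

theorem IsSmallFunction.characteristic_isLittleO {b f : ℂ → ℂ} (h : IsSmallFunction b f) :
    ValueDistribution.characteristic b ⊤ =o[atTopModFinite]
      ValueDistribution.characteristic f ⊤ := by
  obtain ⟨-, -, E, -, hE, hbf⟩ := h
  exact hbf.mono (atTopModFinite_le_inf_principal hE)

theorem logCounting_zero_isBigO_log_of_finite_meromorphicZeros {g : ℂ → ℂ} (hg : Meromorphic g)
    (hfin : (meromorphicZeros g).Finite) :
    ValueDistribution.logCounting g 0 =O[atTop] Real.log := by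
  rw [ValueDistribution.logCounting_zero]
  refine Function.locallyFinsuppWithin.logCounting_isBigO_log_of_finite_support
    (hfin.subset fun z hz ↦ ?_)
  have h1 : (MeromorphicOn.divisor g Set.univ z)⁺ ≠ 0 := hz
  have h2 : 0 < MeromorphicOn.divisor g Set.univ z := by
    by_contra! h
    exact h1 (posPart_of_nonpos h)
  rw [MeromorphicOn.divisor_apply hg.meromorphicOn (Set.mem_univ z)] at h2
  have h3 : meromorphicOrderAt g z ≠ ⊤ := fun h ↦ by simp [h] at h2
  refine ⟨?_, h3⟩
  rw [← WithTop.coe_untop₀_of_ne_top h3]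
  exact_mod_cast h2

theorem corollary2p7 (f a φ : ℂ → ℂ) (k : ℕ) (q : ℕ → ℕ)
    (hf : IsTranscendentalMeromorphic f)
    (hpoles : ∀ z : ℂ, meromorphicOrderAt f z ≠ -1)
    (ha : IsSmallFunction a f) (hφ : IsSmallFunction φ f)
    (hk : 1 ≤ k) (hq0 : 2 ≤ q 0) (hqk : 1 ≤ q k) :
    (meromorphicZeros (fun z ↦ differentialMonomial a k q f z - φ z)).Infinite := by
  intro hfin
  have ham := ha.1
  have hφm := hφ.1
  have ha0 := ham.meromorphicOrderAt_ne_top_of_not_eventuallyEq_zero ha.2.1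
  have hφ0 := hφm.meromorphicOrderAt_ne_top_of_not_eventuallyEq_zero hφ.2.1
  have hφi0 : ∀ z, meromorphicOrderAt φ⁻¹ z ≠ ⊤ := fun z ↦ by
    rw [meromorphicOrderAt_inv]; simpa using hφ0 z
  have hb : Meromorphic (a * φ⁻¹) := ham.mul hφm.inv
  have hb0 : ∀ z, meromorphicOrderAt (a * φ⁻¹) z ≠ ⊤ := fun z ↦ by
    rw [meromorphicOrderAt_mul (ham z) (hφm.inv z)]
    exact WithTop.add_ne_top.2 ⟨ha0 z, hφi0 z⟩
  obtain ⟨B, -, hB⟩ := ValueDistribution.exists_characteristic_inv_le hφm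
  have hbf : ValueDistribution.characteristic (a * φ⁻¹) ⊤ =o[atTopModFinite]
      ValueDistribution.characteristic f ⊤ := by
    refine ValueDistribution.isLittleO_of_eventually_le (ha.characteristic_isLittleO.add
      (hφ.characteristic_isLittleO.add (hf.const_isLittleO B)))
      (IsTranscendentalMeromorphic.eventually_nonneg _) ?_
    filter_upwards [eventually_atTopModFinite_of_atTop
      (ValueDistribution.characteristic_mul_top_eventuallyLE ham ha0 hφm.inv hφi0)] with r hr
    rw [Pi.add_apply] at hr
    linarith [hB r]
  refine hf.not_logCounting_sub_one_isLittleO hpoles hb hb0 hbf hq0 (k := k) rfl ?_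
  set g : ℂ → ℂ := fun z ↦ differentialMonomial a k q f z - φ z with hg
  have hmon : differentialMonomial a k q f = a * derivProd k q f := by
    ext z
    simp [differentialMonomial, derivProd]
  have hgm : Meromorphic g := by
    rw [hg, hmon]
    exact (ham.mul hf.meromorphic_derivProd).sub hφm
  -- Besides the zeros of `g`, only poles of `φ` can give zeros of this product, and `N(r, φ)` is
  -- small.
  have heq : (fun z ↦ (a * φ⁻¹ * derivProd k q f) z - 1) =ᶠ[codiscrete ℂ] g * φ⁻¹ := by
    filter_upwards [hφm.eventually_codiscrete_ne_zero hφ0] with z hz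
    simp only [hg, hmon, Pi.mul_apply, Pi.inv_apply]
    field_simp
  have hgo : ValueDistribution.logCounting g 0 =o[atTopModFinite]
      ValueDistribution.characteristic f ⊤ :=
    ((logCounting_zero_isBigO_log_of_finite_meromorphicZeros hgm hfin).mono
      atTopModFinite_le_atTop).trans_isLittleO hf.log_isLittleO
  rw [ValueDistribution.logCounting_congr_codiscrete heq]
  -- If `g` vanishes identically, it has no zeros of finite order and its counting function is `0`
  -- by convention. The same contradiction then excludes this case.
  by_cases hg0 : g =ᶠ[codiscrete ℂ] 0
  · have h0 : g * φ⁻¹ =ᶠ[codiscrete ℂ] g := hg0.mono fun z hz ↦ by simp [hz]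
    rwa [ValueDistribution.logCounting_congr_codiscrete h0]
  · refine ValueDistribution.isLittleO_of_eventually_le
      (hgo.add hφ.characteristic_isLittleO) ?_ ?_
    · exact eventually_atTopModFinite_of_atTop ((eventually_ge_atTop 1).mono fun r hr ↦
        ValueDistribution.logCounting_nonneg hr)
    · filter_upwards [eventually_atTopModFinite_of_atTop
        (ValueDistribution.logCounting_mul_zero_eventuallyLE hgm
        (hgm.meromorphicOrderAt_ne_top_of_not_eventuallyEq_zero hg0) hφm.inv hφi0)] with r hr
      have h1 := ValueDistribution.logCounting_top_le_characteristic φ r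
      rw [Pi.add_apply, ← ValueDistribution.logCounting_inv (f := φ⁻¹), inv_inv] at hr
      linarith
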